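/- Consider a tandem of two FIFO single-server queues with infinite buffers. Customers are indexed by $n\in\mathbb Z$; $\tau_n\ge 0$ is the time between the arrivals of customers $n$ and $n+1$ at the first queue, and $\sigma^{(i)}_n\ge 0$ is the service time of customer $n$ at queue $i=1,2$. The sequences $\{\tau_n\}$, $\{\sigma^{(1)}_n\}$, $\{\sigma^{(2)}_n\}$ are mutually independent, each of them is i.i.d., and they have finite means $a=\mathbf E\tau_0$, $b^{(i)}=\mathbf E\sigma^{(i)}_0$. The stationary waiting times are $$W^{(1)}_n=\sup_{k\ge 0}\sum_{i=1}^{k}\bigl(\sigma^{(1)}_{n-i}-\tau_{n-i}\bigr),\qquad W^{(2)}_n=\sup_{k\ge 0}\sum_{i=1}^{k}\bigl(\sigma^{(2)}_{n-i}-\tau^{(2)}_{n-i}\bigr),$$ where $\tau^{(2)}_n=-\min\bigl(0,\,W^{(1)}_n+\sigma^{(1)}_n-\tau_n\bigr)+\sigma^{(1)}_{n+1}$ is the time between the arrivals of customers $n$ and $n+1$ at the second queue; put $W^{(2)}=W^{(2)}_0$. A distribution $G$ on $[0,\infty)$ with tail $\overline G(x)=1-G(x)>0$ for all $x$ is called subexponential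 if $\mathbf P(\xi_1+\xi_2>x)/\overline G(x)\to 2$ as $x\to\infty$ for independent $\xi_1,\xi_2$ with distribution $G$. For a distribution $F$ on $[0,\infty)$ with tail $\overline F=1-F$, the integrated tail distribution $F^s$ on $[0,\infty)$ has the tail $\overline{F^s}(x)=\min\bigl\{1,\int_x^\infty\overline F(u)\,du\bigr\}$, $x\ge 0$. **Theorem 10.** Assume that $a>b^{(1)}>b^{(2)}$, and that there are a distribution $F$ on $[0,\infty)$ and a constant $d^{(2)}>0$ such that $F^s$ is subexponential and $\mathbf P(\sigma^{(2)}_0>x)/\overline F(x)\to d^{(2)}$ as $x\to\infty$. Then $$\mathbf P\bigl(W^{(2)}>x\bigr)\sim\frac{d^{(2)}}{a-b^{(2)}}\,\overline{F^s}(x)\qquad\text{as }x\to\infty,$$ that is, the ratio $\mathbf P(W^{(2)}>x)/\overline{F^s}(x)$ tends to $d^{(2)}/(a-b^{(2)})$. Apart from its finite mean, nothing is assumed about the distribution of $\sigma^{(1)}_0$, in particular nothing about its tail; $F$ itself need not be subexponential. -/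

import Mathlib

open MeasureTheory ProbabilityTheory Filter Topology Set
open scoped ENNReal

namespace TandemTail

noncomputable section

/-! ## Subexponential laws and the integrated tail law -/

/-- The tail `x ↦ G (x, ∞)` of a law `G` on the line. -/
def tail (G : Measure ℝ) (x : ℝ) : ℝ := G.real (Ioi x)

/-- Subexponentiality of a law `G` on `[0, ∞)`: it is a probability law carried by `[0, ∞)`, its
tail never vanishes, and the sum of two independent variables with law `G` (its law is the
convolution of `G` with itself) has a tail equivalent to twice the tail of `G`. -/
structure IsSubexponential (G : Measure ℝ) : Prop where
  isProbabilityMeasure : IsProbabilityMeasure G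
  nonneg : G (Iio 0) = 0
  tail_pos : ∀ x, 0 < tail G x
  tendsto_conv : Tendsto (fun x => tail (G.conv G) x / tail G x) atTop (𝓝 2)

/-- The integrated tail `min {1, ∫_x^∞ F(u, ∞) du}` of a law `F`. The integral has values in
`[0, ∞]`, so that the minimum is `1` if the integral diverges. -/
def integratedTail (F : Measure ℝ) (x : ℝ) : ℝ :=
  (min 1 (∫⁻ u in Ioi x, F (Ioi u))).toReal

theorem integratedTail_le_one (F : Measure ℝ) (x : ℝ) : integratedTail F x ≤ 1 := by
  have h := ENNReal.toReal_mono ENNReal.one_ne_top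
    (min_le_left (1 : ℝ≥0∞) (∫⁻ u in Ioi x, F (Ioi u)))
  simpa [integratedTail] using h

theorem integratedTail_antitone (F : Measure ℝ) : Antitone (integratedTail F) := by
  intro x y hxy
  refine ENNReal.toReal_mono (ne_top_of_le_ne_top ENNReal.one_ne_top (min_le_left _ _)) ?_
  exact min_le_min le_rfl (lintegral_mono_set (Ioi_subset_Ioi hxy))

theorem integratedTail_le_add (F : Measure ℝ) [IsProbabilityMeasure F] {x y : ℝ} (hxy : x ≤ y) :
    integratedTail F x ≤ integratedTail F y + (y - x) := by
  have h1 : (∫⁻ u in Ioi x, F (Ioi u))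
      ≤ (∫⁻ u in Ioi y, F (Ioi u)) + ENNReal.ofReal (y - x) := by
    rw [← Ioc_union_Ioi_eq_Ioi hxy, add_comm]
    refine (lintegral_union_le _ _ _).trans (add_le_add ?_ le_rfl)
    calc (∫⁻ u in Ioc x y, F (Ioi u)) ≤ ∫⁻ _ in Ioc x y, 1 :=
          lintegral_mono fun u => prob_le_one
      _ = ENNReal.ofReal (y - x) := by simp
  have h2 : min 1 (∫⁻ u in Ioi x, F (Ioi u))
      ≤ min 1 (∫⁻ u in Ioi y, F (Ioi u)) + ENNReal.ofReal (y - x) := by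
    rcases le_total 1 (∫⁻ u in Ioi y, F (Ioi u)) with h | h
    · rw [min_eq_left h]
      exact (min_le_left _ _).trans le_self_add
    · rw [min_eq_right h]
      exact (min_le_right _ _).trans h1
  have h3 : min 1 (∫⁻ u in Ioi y, F (Ioi u)) ≠ ∞ :=
    ne_top_of_le_ne_top ENNReal.one_ne_top (min_le_left _ _)
  have h4 := ENNReal.toReal_mono (ENNReal.add_ne_top.2 ⟨h3, ENNReal.ofReal_ne_top⟩) h2
  rwa [ENNReal.toReal_add h3 ENNReal.ofReal_ne_top,
    ENNReal.toReal_ofReal (sub_nonneg.2 hxy)] at h4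

theorem integratedTail_continuous (F : Measure ℝ) [IsProbabilityMeasure F] :
    Continuous (integratedTail F) := by
  refine LipschitzWith.continuous (K := 1) (LipschitzWith.of_le_add fun x y => ?_)
  rcases le_total x y with h | h
  · have := integratedTail_le_add F h
    rw [Real.dist_eq, abs_sub_comm, abs_of_nonneg (sub_nonneg.2 h)]
    exact this
  · exact (integratedTail_antitone F h).trans (le_add_of_nonneg_right dist_nonneg)

/-- The integrated tail distribution function: `0` on `(-∞, 0)`, and
`1 - min {1, ∫_x^∞ F(u, ∞) du}` at `x ≥ 0`. -/
def integratedTailCDF (F : Measure ℝ) [IsProbabilityMeasure F] : StieltjesFunction ℝ where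
  toFun x := if x < 0 then 0 else 1 - integratedTail F x
  mono' := by
    intro x y hxy
    have h0 := integratedTail_le_one F y
    have h1 := integratedTail_antitone F hxy
    dsimp only
    split_ifs <;> linarith
  right_continuous' := by
    intro x
    rcases lt_or_ge x 0 with h | h
    · have : (fun z : ℝ => if z < 0 then 0 else 1 - integratedTail F z)
          =ᶠ[𝓝 x] fun _ => (0 : ℝ) := by
        filter_upwards [Iio_mem_nhds h] with z hz
        exact if_pos hz
      exact (continuousAt_const.congr this.symm).continuousWithinAt
    · have hc : Continuous fun z => 1 - integratedTail F z :=
        continuous_const.sub (integratedTail_continuous F)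
      refine hc.continuousWithinAt.congr ?_ ?_
      · intro z hz
        exact if_neg (not_lt.2 (h.trans hz))
      · exact if_neg (not_lt.2 h)

/-- The integrated tail law `F^s` of a law `F` on `[0, ∞)`, given by its distribution function. -/
def integratedTailLaw (F : Measure ℝ) [IsProbabilityMeasure F] : Measure ℝ :=
  (integratedTailCDF F).measure

/-! ## The tandem queue

Customers are numbered by `ℤ`. `τ n` is the time between the arrivals of customers `n` and `n + 1`
at the first queue, `σ₁ n` and `σ₂ n` are the service times of customer `n` at the two queues.
Everything below is a function of one realization of these sequences. -/

/-- The waiting time of customer `n` in a stationary FIFO single-server queue in which `ξ m` is the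
service time of customer `m` minus the time between the arrivals of customers `m` and `m + 1`:
the supremum over `k ≥ 0` of the sums `ξ (n - 1) + ⋯ + ξ (n - k)` (`k = 0` gives `0`), a value in
`[0, ∞]`. -/
def waiting (ξ : ℤ → ℝ) (n : ℤ) : EReal :=
  ⨆ k : ℕ, ((∑ i ∈ Finset.range k, ξ (n - 1 - i) : ℝ) : EReal)

/-- Lindley's recursion for the stationary waiting times. -/
theorem waiting_add_one (ξ : ℤ → ℝ) (n : ℤ) :
    waiting ξ (n + 1) = max 0 (waiting ξ n + (ξ n : EReal)) := by
  have hsum : ∀ k : ℕ, ∑ i ∈ Finset.range (k + 1), ξ (n + 1 - 1 - i)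
      = ∑ i ∈ Finset.range k, ξ (n - 1 - i) + ξ n := by
    intro k
    rw [Finset.sum_range_succ']
    congr 1
    · refine Finset.sum_congr rfl fun i _ => ?_
      congr 1
      push_cast
      ring
    · simp
  have hstep : ∀ k : ℕ, ((∑ i ∈ Finset.range (k + 1), ξ (n + 1 - 1 - i) : ℝ) : EReal)
      = ((∑ i ∈ Finset.range k, ξ (n - 1 - i) : ℝ) : EReal) + (ξ n : EReal) := by
    intro k
    rw [hsum k, EReal.coe_add]
  apply le_antisymm
  · refine iSup_le fun k => ?_
    cases k with
    | zero => simp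
    | succ k =>
      rw [hstep k]
      exact (add_le_add (le_iSup (fun k : ℕ =>
        ((∑ i ∈ Finset.range k, ξ (n - 1 - i) : ℝ) : EReal)) k) le_rfl).trans (le_max_right _ _)
  · refine max_le ?_ ?_
    · refine le_iSup_of_le 0 ?_
      simp
    · rw [← EReal.le_sub_iff_add_le (Or.inl (EReal.coe_ne_bot _)) (Or.inl (EReal.coe_ne_top _))]
      refine iSup_le fun k => ?_
      rw [EReal.le_sub_iff_add_le (Or.inl (EReal.coe_ne_bot _)) (Or.inl (EReal.coe_ne_top _)),
        ← hstep k]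
      exact le_iSup (fun k : ℕ =>
        ((∑ i ∈ Finset.range k, ξ (n + 1 - 1 - i) : ℝ) : EReal)) (k + 1)

/-- The stationary waiting time `W⁽¹⁾` of customer `n` at the first queue. -/
def waitingFirst (τ σ₁ : ℤ → ℝ) (n : ℤ) : EReal :=
  waiting (fun m => σ₁ m - τ m) n

/-- The time between the arrivals of customers `n` and `n + 1` at the second queue, that is, between
their departures from the first queue: the time during which the first server is idle between
the two services, `- min (0, W⁽¹⁾ + σ₁ n - τ n)`, plus the service time of customer `n + 1`. The
idle time is finite because `0 ≤ W⁽¹⁾`; it is `0` if `W⁽¹⁾ = ∞`. -/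
def interarrivalSecond (τ σ₁ : ℤ → ℝ) (n : ℤ) : ℝ :=
  (-(min 0 (waitingFirst τ σ₁ n + ((σ₁ n - τ n : ℝ) : EReal)))).toReal + σ₁ (n + 1)

/-- The stationary waiting time `W⁽²⁾` of customer `n` at the second queue. -/
def waitingSecond (τ σ₁ σ₂ : ℤ → ℝ) (n : ℤ) : EReal :=
  waiting (fun m => σ₂ m - interarrivalSecond τ σ₁ m) n

end

end TandemTail

/-! The waiting time `W⁽²⁾` is the supremum over `k` of `S_k - T_k`. Here `S_k` is the sum of the
last `k` service times at the second queue, and `T_k` is the sum of the last `k` interarrival times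
there. Since `T` is a function of `τ` and `σ₁` only, it is independent of `S`. Moreover `T_k / k →
a` almost surely: by Lindley's recursion `T_k` equals a sum of `k` variables `τ` plus differences of
waiting times and of sums of `σ₁`, all of which are `o(k)`. The process thus behaves like a random
walk with drift `-(a - b₂)`, whose maximum exceeds a high level through one big service. Summing
`P(σ₂ > x + (a - b₂) n)` over `n` gives the stated asymptotics.

For random walks the upper bound is `IsSubexponential.maxWalk_tail_le`. It decomposes the path at
its first crossing of a falling line, which yields a renewal inequality whose kernel has small mass
(`IsSubexponential.eventually_tail_le_of_renewal`). The lower bound,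
`IsSubexponential.eventually_le_walk_tail`, adds the probabilities of disjoint single-jump events.
The subexponential law enters only through insensitivity of its tail to shifts and through the small
probability that two large terms share in exceeding `x`.

It remains to replace `T_k` by a line. For the lower bound take `c > a`: with probability close to
one `T_k ≤ c k + R` for all `k`, independently of the services. For the upper bound take `c < a`:
outside an event `B` of probability below `η`, `T_k ≥ c k - R` for all `k`. On `B` only the crude
bound of `T_k` from below by a sum of `k` variables `σ₁` is left. With `b₂ < c' < b₁`, `S_k - T_k`
is at most the maximum of a walk with steps `σ₂ - c'`, independent of `B` and with tail of the order
of that of `F^s`, plus the maximum of a walk with steps `c' - σ₁`, which are bounded above, so that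
its tail is negligible. Hence `B` contributes at most a multiple of `η` times the tail of `F^s`.
This is where `b₂ < b₁` enters, and why the tail of `σ₁` plays no role. -/

namespace TandemTail

/-! ### Subexponential tails: insensitivity to shifts, and two large summands. -/

section Subexponential

variable {G : Measure ℝ}

/-- The probability that two independent variables with law `G` both exceed `A` and that their sum
exceeds `x`. -/
noncomputable def jointTail (G : Measure ℝ) (A x : ℝ) : ℝ :=
  (G.prod G).real {p | A < p.1 ∧ A < p.2 ∧ x < p.1 + p.2}

theorem tail_nonneg (G : Measure ℝ) (x : ℝ) : 0 ≤ tail G x := measureReal_nonneg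

theorem tail_antitone (G : Measure ℝ) [IsFiniteMeasure G] : Antitone (tail G) :=
  fun _ _ h => measureReal_mono (Ioi_subset_Ioi h)

theorem tendsto_tail_atTop (G : Measure ℝ) [IsFiniteMeasure G] :
    Tendsto (tail G) atTop (𝓝 0) := by
  have h := tendsto_measure_iInter_atTop (μ := G) (s := fun x : ℝ => Ioi x)
    (fun x => measurableSet_Ioi.nullMeasurableSet) (fun _ _ h => Ioi_subset_Ioi h)
    ⟨0, measure_ne_top _ _⟩
  have h0 : (⋂ x : ℝ, Ioi x) = ∅ := by
    ext y
    simp only [mem_iInter, mem_Ioi, mem_empty_iff_false, iff_false, not_forall, not_lt]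
    exact ⟨y, le_rfl⟩
  rw [h0, measure_empty] at h
  exact (ENNReal.tendsto_toReal ENNReal.zero_ne_top).comp h

theorem tail_conv_eq (G : Measure ℝ) [SFinite G] (x : ℝ) :
    tail (G.conv G) x = (G.prod G).real {p | x < p.1 + p.2} := by
  rw [tail, Measure.conv, measureReal_def, Measure.map_apply (by fun_prop) measurableSet_Ioi]
  rfl

theorem measurableSet_lt_add (x : ℝ) : MeasurableSet {p : ℝ × ℝ | x < p.1 + p.2} :=
  measurableSet_lt measurable_const (by fun_prop)

theorem measurableSet_jointTail (A x : ℝ) :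
    MeasurableSet {p : ℝ × ℝ | A < p.1 ∧ A < p.2 ∧ x < p.1 + p.2} :=
  (measurableSet_lt measurable_const measurable_fst).inter
    ((measurableSet_lt measurable_const measurable_snd).inter (measurableSet_lt_add x))

theorem real_Iic_eq (G : Measure ℝ) [IsProbabilityMeasure G] (A : ℝ) :
    G.real (Iic A) = 1 - tail G A := by
  rw [← compl_Ioi, probReal_compl_eq_one_sub measurableSet_Ioi]
  rfl

theorem ae_prod_nonneg [IsProbabilityMeasure G] (h : G (Iio 0) = 0) :
    ∀ᵐ p ∂(G.prod G), 0 ≤ p.1 ∧ 0 ≤ p.2 := by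
  have h' : ∀ᵐ y ∂G, 0 ≤ y := by
    rw [ae_iff]
    simpa [Iio] using h
  have h1 : ∀ᵐ p ∂(G.prod G), 0 ≤ p.1 := Measure.quasiMeasurePreserving_fst.ae h'
  have h2 : ∀ᵐ p ∂(G.prod G), 0 ≤ p.2 := Measure.quasiMeasurePreserving_snd.ae h'
  filter_upwards [h1, h2] with p a b using ⟨a, b⟩

/-- The inclusions are only almost sure because nonnegativity of the summands is. -/
theorem measureReal_union_three_le {α : Type*} [MeasurableSpace α] {μ : Measure α}
    [IsFiniteMeasure μ] {s t u v : Set α} (ht : MeasurableSet t) (hu : MeasurableSet u)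
    (hst : Disjoint s t) (hsu : Disjoint s u) (htu : Disjoint t u)
    (hs' : ∀ᵐ p ∂μ, p ∈ s → p ∈ v) (ht' : ∀ᵐ p ∂μ, p ∈ t → p ∈ v)
    (hu' : ∀ᵐ p ∂μ, p ∈ u → p ∈ v) :
    μ.real s + μ.real t + μ.real u ≤ μ.real v := by
  rw [← measureReal_union hst ht, ← measureReal_union (disjoint_union_left.2 ⟨hsu, htu⟩) hu]
  refine ENNReal.toReal_mono (measure_ne_top _ _) (measure_mono_ae ?_)
  filter_upwards [hs', ht', hu'] with p h1 h2 h3 hp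
  rcases hp with (hp | hp) | hp
  exacts [h1 hp, h2 hp, h3 hp]

/-- The three terms are the masses of disjoint rectangles inside the half-plane: first coordinate
beyond `x`; at most `A` with the second beyond `x`; between `A` and `x` with the second beyond `x -
A`. -/
theorem tail_conv_ge_of_le [IsProbabilityMeasure G] (h : G (Iio 0) = 0) {A x : ℝ}
    (hAx : A ≤ x) :
    tail G x + (1 - tail G A) * tail G x + (tail G A - tail G x) * tail G (x - A)
      ≤ tail (G.conv G) x := by
  have e1 : tail G x = (G.prod G).real (Ioi x ×ˢ univ) := by
    rw [measureReal_prod_prod]; simp [tail]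
  have e2 : (1 - tail G A) * tail G x = (G.prod G).real (Iic A ×ˢ Ioi x) := by
    rw [measureReal_prod_prod, real_Iic_eq]; rfl
  have e3 : (tail G A - tail G x) * tail G (x - A)
      = (G.prod G).real (Ioc A x ×ˢ Ioi (x - A)) := by
    rw [measureReal_prod_prod, ← Ioi_sdiff_Ioi,
      measureReal_sdiff (Ioi_subset_Ioi hAx) measurableSet_Ioi]
    rfl
  rw [tail_conv_eq]
  nth_rewrite 1 [e1]
  rw [e2, e3]
  refine measureReal_union_three_le (measurableSet_Iic.prod measurableSet_Ioi)
    (measurableSet_Ioc.prod measurableSet_Ioi) ?_ ?_ ?_ ?_ ?_ ?_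
  · rw [Set.disjoint_left]
    rintro ⟨p, q⟩ h1 h2
    simp only [mem_prod, mem_Ioi, mem_Iic] at h1 h2
    linarith [h1.1, h2.1]
  · rw [Set.disjoint_left]
    rintro ⟨p, q⟩ h1 h2
    simp only [mem_prod, mem_Ioi, mem_Ioc] at h1 h2
    linarith [h1.1, h2.1.2]
  · rw [Set.disjoint_left]
    rintro ⟨p, q⟩ h1 h2
    simp only [mem_prod, mem_Iic, mem_Ioc] at h1 h2
    linarith [h1.1, h2.1.1]
  all_goals
    filter_upwards [ae_prod_nonneg h] with p hp hm
    simp only [mem_prod, mem_Ioi, mem_Ioc, mem_Iic] at hm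
    linarith [hm.1, hm.2, hp.1, hp.2]

theorem jointTail_add_le [IsProbabilityMeasure G] (h : G (Iio 0) = 0) {A x : ℝ} (hAx : A ≤ x) :
    jointTail G A x + (1 - tail G A) * tail G x + (1 - tail G A) * tail G x
      ≤ tail (G.conv G) x := by
  have e2 : (1 - tail G A) * tail G x = (G.prod G).real (Iic A ×ˢ Ioi x) := by
    rw [measureReal_prod_prod, real_Iic_eq]; rfl
  have e3 : (1 - tail G A) * tail G x = (G.prod G).real (Ioi x ×ˢ Iic A) := by
    rw [measureReal_prod_prod, real_Iic_eq, mul_comm]; rfl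
  rw [tail_conv_eq]
  nth_rewrite 2 [e3]
  rw [e2, jointTail]
  refine measureReal_union_three_le (measurableSet_Iic.prod measurableSet_Ioi)
    (measurableSet_Ioi.prod measurableSet_Iic) ?_ ?_ ?_ ?_ ?_ ?_
  · rw [Set.disjoint_left]
    rintro ⟨p, q⟩ h1 h2
    simp only [mem_prod, mem_ofPred_eq, mem_Ioi, mem_Iic] at h1 h2
    linarith [h1.1, h2.1]
  · rw [Set.disjoint_left]
    rintro ⟨p, q⟩ h1 h2
    simp only [mem_prod, mem_ofPred_eq, mem_Ioi, mem_Iic] at h1 h2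
    linarith [h1.2.1, h2.2]
  · rw [Set.disjoint_left]
    rintro ⟨p, q⟩ h1 h2
    simp only [mem_prod, mem_Ioi, mem_Iic] at h1 h2
    linarith [h1.1, h2.1]
  · exact Eventually.of_forall fun p hp => hp.2.2
  all_goals
    filter_upwards [ae_prod_nonneg h] with p hp hm
    simp only [mem_prod, mem_Ioi, mem_Iic] at hm
    linarith [hm.1, hm.2, hp.1, hp.2]

/-- In `tail_conv_ge_of_le`, divided by `tail G x`, the right side tends to `2`; solving for the
ratio `tail G (x - A) / tail G x` leaves an upper bound tending to `tail G A / tail G A = 1`. -/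
theorem IsSubexponential.tendsto_tail_sub_of_nonneg (hG : IsSubexponential G) {A : ℝ}
    (hA : 0 ≤ A) : Tendsto (fun x => tail G (x - A) / tail G x) atTop (𝓝 1) := by
  have := hG.isProbabilityMeasure
  have hAp := hG.tail_pos A
  have hlim : Tendsto (fun x => (tail (G.conv G) x / tail G x - 2 + tail G A)
      / (tail G A - tail G x)) atTop (𝓝 1) := by
    have h1 := ((hG.tendsto_conv.sub_const 2).add_const (tail G A)).div
      ((tendsto_tail_atTop G).const_sub (tail G A)) (by simpa using hAp.ne')
    rw [sub_self, zero_add, sub_zero, div_self hAp.ne'] at h1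
    exact h1
  refine tendsto_of_tendsto_of_tendsto_of_le_of_le' tendsto_const_nhds hlim ?_ ?_
  · refine Eventually.of_forall fun x => ?_
    rw [le_div_iff₀ (hG.tail_pos x), one_mul]
    exact tail_antitone G (by linarith)
  · filter_upwards [(tendsto_tail_atTop G).eventually (gt_mem_nhds hAp), eventually_ge_atTop A]
      with x hx hAx
    have hxp := hG.tail_pos x
    have h1 := tail_conv_ge_of_le hG.nonneg hAx
    rw [le_div_iff₀ (sub_pos.2 hx), div_mul_eq_mul_div, div_le_iff₀ hxp]
    have : (tail (G.conv G) x / tail G x - 2 + tail G A) * tail G x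
        = tail (G.conv G) x - 2 * tail G x + tail G A * tail G x := by
      field_simp
    rw [this]
    nlinarith

theorem IsSubexponential.tendsto_tail_sub (hG : IsSubexponential G) (A : ℝ) :
    Tendsto (fun x => tail G (x - A) / tail G x) atTop (𝓝 1) := by
  rcases le_total 0 A with hA | hA
  · exact hG.tendsto_tail_sub_of_nonneg hA
  · have h := (hG.tendsto_tail_sub_of_nonneg (neg_nonneg.2 hA)).comp
      (tendsto_atTop_add_const_right atTop (-A) tendsto_id)
    have h' := h.inv₀ one_ne_zero
    rw [inv_one] at h'
    refine h'.congr fun x => ?_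
    simp [sub_eq_add_neg]

theorem IsSubexponential.eventually_tail_sub_le (hG : IsSubexponential G) (A : ℝ) {r : ℝ}
    (hr : 1 < r) : ∀ᶠ x in atTop, tail G (x - A) ≤ r * tail G x := by
  filter_upwards [(hG.tendsto_tail_sub A).eventually (gt_mem_nhds hr)] with x hx
  exact ((div_lt_iff₀ (hG.tail_pos x)).1 hx).le

theorem IsSubexponential.eventually_le_tail_sub (hG : IsSubexponential G) (A : ℝ) {r : ℝ}
    (hr : r < 1) : ∀ᶠ x in atTop, r * tail G x ≤ tail G (x - A) := by
  filter_upwards [(hG.tendsto_tail_sub A).eventually (lt_mem_nhds hr)] with x hx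
  exact ((lt_div_iff₀ (hG.tail_pos x)).1 hx).le

/-- Removing the two rectangles of `jointTail_add_le` from a convolution tail of about `2 * tail G
x` leaves about `2 * tail G A * tail G x`; the factor `3` is slack. The bound is small relative to
`tail G x` for large `A`. -/
theorem IsSubexponential.eventually_jointTail_le (hG : IsSubexponential G) (A : ℝ) :
    ∀ᶠ x in atTop, jointTail G A x ≤ 3 * tail G A * tail G x := by
  have := hG.isProbabilityMeasure
  have hA := hG.tail_pos A
  filter_upwards [hG.tendsto_conv.eventually
      (gt_mem_nhds (show (2 : ℝ) < 2 + tail G A by linarith)),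
    eventually_ge_atTop A] with x hx hAx
  have h1 := jointTail_add_le hG.nonneg hAx
  have h2 := (div_lt_iff₀ (hG.tail_pos x)).1 hx
  nlinarith

end Subexponential

/-! ### Sums with dominated tails and the defective renewal inequality. -/

section Comparison

variable {G : Measure ℝ}

theorem setOf_snd_section (A x y : ℝ) :
    {z : ℝ | A < y ∧ A < z ∧ x < y + z} = if A < y then Ioi (max A (x - y)) else ∅ := by
  split_ifs with h
  · ext z; simp only [mem_ofPred_eq, mem_Ioi, max_lt_iff, h, true_and, sub_lt_iff_lt_add']
  · ext z; simp [h]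

theorem setOf_fst_section (A x z : ℝ) :
    {y : ℝ | A < y ∧ A < z ∧ x < y + z} = if A < z then Ioi (max A (x - z)) else ∅ := by
  split_ifs with h
  · ext y; simp only [mem_ofPred_eq, mem_Ioi, max_lt_iff, h, true_and, sub_lt_iff_lt_add]
  · ext z; simp [h]

/-- Two laws whose tails are dominated beyond `A` by multiples of the tail of `G`: the joint tail
beyond `A` is dominated too. -/
theorem prod_jointTail_le {ν θ : Measure ℝ} [IsFiniteMeasure ν] [IsFiniteMeasure θ]
    [IsFiniteMeasure G] {A C K x : ℝ} (hC : 0 ≤ C) (hK : 0 ≤ K)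
    (hν : ∀ t ≥ A, ν.real (Ioi t) ≤ C * tail G t)
    (hθ : ∀ t ≥ A, θ.real (Ioi t) ≤ K * tail G t) :
    (ν.prod θ).real {p | A < p.1 ∧ A < p.2 ∧ x < p.1 + p.2} ≤ C * K * jointTail G A x := by
  have conv : ∀ {μ : Measure ℝ} [IsFiniteMeasure μ] {c t : ℝ}, 0 ≤ c →
      μ.real (Ioi t) ≤ c * tail G t → μ (Ioi t) ≤ ENNReal.ofReal c * G (Ioi t) := by
    intro μ _ c t hc h
    rw [← ofReal_measureReal (μ := μ), ← ofReal_measureReal (μ := G), ← ENNReal.ofReal_mul hc]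
    exact ENNReal.ofReal_le_ofReal h
  have hm := measurableSet_jointTail A x
  have h1 : (ν.prod θ) {p | A < p.1 ∧ A < p.2 ∧ x < p.1 + p.2}
      ≤ ENNReal.ofReal K * (ν.prod G) {p | A < p.1 ∧ A < p.2 ∧ x < p.1 + p.2} := by
    rw [Measure.prod_apply hm, Measure.prod_apply hm,
      ← lintegral_const_mul' _ _ ENNReal.ofReal_ne_top]
    refine lintegral_mono fun y => ?_
    simp only [preimage_ofPred_eq, setOf_snd_section]
    split_ifs
    · exact conv hK (hθ _ (le_max_left _ _))
    · simp
  have h2 : (ν.prod G) {p | A < p.1 ∧ A < p.2 ∧ x < p.1 + p.2}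
      ≤ ENNReal.ofReal C * (G.prod G) {p | A < p.1 ∧ A < p.2 ∧ x < p.1 + p.2} := by
    rw [Measure.prod_apply_symm hm, Measure.prod_apply_symm hm,
      ← lintegral_const_mul' _ _ ENNReal.ofReal_ne_top]
    refine lintegral_mono fun y => ?_
    simp only [preimage_ofPred_eq, setOf_fst_section]
    split_ifs
    · exact conv hC (hν _ (le_max_left _ _))
    · simp
  have h3 := ENNReal.toReal_mono (ENNReal.mul_ne_top ENNReal.ofReal_ne_top
    (ENNReal.mul_ne_top ENNReal.ofReal_ne_top (measure_ne_top _ _)))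
    (h1.trans (mul_le_mul_right h2 _))
  rw [ENNReal.toReal_mul, ENNReal.toReal_mul, ENNReal.toReal_ofReal hC,
    ENNReal.toReal_ofReal hK, ← mul_assoc, mul_comm K C] at h3
  exact h3

/-- The tail of a sum of independent variables, split according to which of the summands is
large. -/
theorem prod_real_lt_add_le {ν θ : Measure ℝ} [IsFiniteMeasure ν] [IsFiniteMeasure θ]
    [IsFiniteMeasure G] {A C K x : ℝ} (hC : 0 ≤ C) (hK : 0 ≤ K)
    (hν : ∀ t ≥ A, ν.real (Ioi t) ≤ C * tail G t)
    (hθ : ∀ t ≥ A, θ.real (Ioi t) ≤ K * tail G t) :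
    (ν.prod θ).real {p | x < p.1 + p.2}
      ≤ ν.real univ * θ.real (Ioi (x - A)) + ν.real (Ioi (x - A)) * θ.real univ
        + C * K * jointTail G A x := by
  have hsub : {p : ℝ × ℝ | x < p.1 + p.2} ⊆ (univ ×ˢ Ioi (x - A) ∪ Ioi (x - A) ×ˢ univ)
      ∪ {p | A < p.1 ∧ A < p.2 ∧ x < p.1 + p.2} := by
    rintro ⟨y, z⟩ h
    simp only [mem_ofPred_eq] at h
    simp only [mem_union, mem_prod, mem_univ, mem_Ioi, true_and, and_true, mem_ofPred_eq]
    by_cases h1 : A < y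
    · by_cases h2 : A < z
      · exact Or.inr ⟨h1, h2, h⟩
      · exact Or.inl (Or.inr (by linarith))
    · exact Or.inl (Or.inl (by linarith))
  refine (measureReal_mono hsub).trans ((measureReal_union_le _ _).trans ?_)
  refine add_le_add ((measureReal_union_le _ _).trans ?_) (prod_jointTail_le hC hK hν hθ)
  rw [measureReal_prod_prod, measureReal_prod_prod]

/-- A defective renewal inequality, first step: some multiple of the tail of `G` is an upper
bound. -/
theorem IsSubexponential.exists_tail_le_of_renewal (hG : IsSubexponential G)
    {θ ν : ℕ → Measure ℝ} [∀ n, IsProbabilityMeasure (θ n)] [∀ n, IsFiniteMeasure (ν n)]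
    {γ C R : ℝ} (hγ : γ < 1) (hC : 0 ≤ C) (hνγ : ∀ n, (ν n).real univ ≤ γ)
    {t₀ : ℝ} (hνC : ∀ n, ∀ t ≥ t₀, (ν n).real (Ioi t) ≤ C * tail G t)
    (h0 : ∀ x ≥ R, (θ 0).real (Ioi x) = 0)
    (hrec : ∀ n, ∀ x ≥ R, (θ (n + 1)).real (Ioi x)
      ≤ ((ν n).prod (θ n)).real {p | x < p.1 + p.2}) :
    ∃ K, 0 ≤ K ∧ ∃ x₁, ∀ n, ∀ x ≥ x₁, (θ n).real (Ioi x) ≤ K * tail G x := by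
  have := hG.isProbabilityMeasure
  have hγ0 : 0 ≤ γ := measureReal_nonneg.trans (hνγ 0)
  -- With `γ = 1 - 4 s`, the induction returns at most `(1 - 3 s) K + 2 C + s K`, which is at most
  -- `K` once `2 C ≤ K s`.
  set s := (1 - γ) / 4 with hs
  have hs0 : 0 < s := by linarith
  have hlim : Tendsto (fun A => C * (3 * tail G A)) atTop (𝓝 (C * (3 * 0))) :=
    ((tendsto_tail_atTop G).const_mul 3).const_mul C
  rw [mul_zero, mul_zero] at hlim
  obtain ⟨A, hA1, hA2⟩ := ((hlim.eventually (gt_mem_nhds hs0)).and (eventually_ge_atTop t₀)).exists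
  obtain ⟨x₀, hx₀⟩ := eventually_atTop.1 ((hG.eventually_tail_sub_le A
    (show (1 : ℝ) < 1 + s by linarith)).and ((hG.eventually_jointTail_le A).and
      ((eventually_ge_atTop R).and (eventually_ge_atTop (A + A)))))
  have hHx0 := hG.tail_pos x₀
  -- The first entry makes the bound trivial below `x₀`, the second closes the induction beyond it.
  set K := max (1 / tail G x₀) (2 * C / s) with hK
  have hK0 : 0 ≤ K := (by positivity : 0 ≤ 1 / tail G x₀).trans (le_max_left _ _)
  have hKC : 2 * C ≤ K * s := by
    rw [← div_le_iff₀ hs0]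
    exact le_max_right _ _
  have hsmall : ∀ n, ∀ x < x₀, (θ n).real (Ioi x) ≤ K * tail G x := by
    intro n x hx
    have h1 : tail G x₀ ≤ tail G x := tail_antitone G hx.le
    have h2 : 1 / tail G x₀ ≤ K := le_max_left _ _
    have h3 : (1 / tail G x₀) * tail G x₀ = 1 := one_div_mul_cancel hHx0.ne'
    have h4 : (θ n).real (Ioi x) ≤ 1 := measureReal_le_one
    nlinarith
  have key : ∀ n, ∀ x, (θ n).real (Ioi x) ≤ K * tail G x := by
    intro n
    induction n with
    | zero =>
      intro x
      rcases lt_or_ge x x₀ with hx | hx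
      · exact hsmall 0 x hx
      · rw [h0 x (hx₀ x hx).2.2.1]
        exact mul_nonneg hK0 (tail_nonneg G x)
    | succ n ih =>
      intro x
      rcases lt_or_ge x x₀ with hx | hx
      · exact hsmall _ x hx
      · obtain ⟨h1, h2, h3, h4⟩ := hx₀ x hx
        have hH := hG.tail_pos x
        have a1 := prod_real_lt_add_le (x := x) hC hK0
          (fun t ht => hνC n t (hA2.trans ht)) (fun t _ => ih t)
        have a2 := hνC n (x - A) (by linarith)
        have a3 := ih (x - A)
        have a5 : (ν n).real univ * (θ n).real (Ioi (x - A)) ≤ γ * (K * ((1 + s) * tail G x)) :=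
          mul_le_mul (hνγ n) (a3.trans (mul_le_mul_of_nonneg_left h1 hK0)) measureReal_nonneg hγ0
        have a6 : (ν n).real (Ioi (x - A)) ≤ C * ((1 + s) * tail G x) :=
          a2.trans (mul_le_mul_of_nonneg_left h1 hC)
        have a7 : C * K * jointTail G A x ≤ C * K * (3 * tail G A * tail G x) :=
          mul_le_mul_of_nonneg_left h2 (mul_nonneg hC hK0)
        have a8 : C * K * (3 * tail G A * tail G x) ≤ s * (K * tail G x) := by
          have := mul_le_mul_of_nonneg_right hA1.le (mul_nonneg hK0 hH.le)
          linarith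
        rw [probReal_univ (μ := θ n), mul_one] at a1
        have a9 : (θ (n + 1)).real (Ioi x)
            ≤ (γ * (1 + s) * K + C * (1 + s) + s * K) * tail G x := by
          linarith [hrec n x h3]
        refine a9.trans (mul_le_mul_of_nonneg_right ?_ hH.le)
        have a10 : γ * (1 + s) ≤ 1 - 3 * s := by nlinarith
        have a11 : C * (1 + s) ≤ 2 * C := by nlinarith
        nlinarith
  exact ⟨K, hK0, 0, fun n x _ => key n x⟩

/-- A defective renewal inequality, iteration of the bound. -/
theorem IsSubexponential.eventually_tail_le_of_renewal_step (hG : IsSubexponential G)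
    {θ ν : ℕ → Measure ℝ} [∀ n, IsProbabilityMeasure (θ n)] [∀ n, IsFiniteMeasure (ν n)]
    {γ C R : ℝ} (hC : 0 ≤ C) (hνγ : ∀ n, (ν n).real univ ≤ γ)
    {t₀ : ℝ} (hνC : ∀ n, ∀ t ≥ t₀, (ν n).real (Ioi t) ≤ C * tail G t)
    (h0 : ∀ x ≥ R, (θ 0).real (Ioi x) = 0)
    (hrec : ∀ n, ∀ x ≥ R, (θ (n + 1)).real (Ioi x)
      ≤ ((ν n).prod (θ n)).real {p | x < p.1 + p.2})
    {K x₁ : ℝ} (hK : 0 ≤ K) (hθ : ∀ n, ∀ x ≥ x₁, (θ n).real (Ioi x) ≤ K * tail G x)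
    {K' : ℝ} (hK' : γ * K + C < K') :
    ∃ x₂, ∀ n, ∀ x ≥ x₂, (θ n).real (Ioi x) ≤ K' * tail G x := by
  have := hG.isProbabilityMeasure
  have hγ0 : 0 ≤ γ := measureReal_nonneg.trans (hνγ 0)
  set η := K' - (γ * K + C) with hη
  have hη0 : 0 < η := sub_pos.2 hK'
  have hlim : Tendsto (fun A => C * K * (3 * tail G A)) atTop (𝓝 (C * K * (3 * 0))) :=
    ((tendsto_tail_atTop G).const_mul 3).const_mul (C * K)
  rw [mul_zero, mul_zero] at hlim
  obtain ⟨A, hA1, hA2, hA3⟩ := ((hlim.eventually (gt_mem_nhds (half_pos hη0))).and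
    ((eventually_ge_atTop t₀).and (eventually_ge_atTop x₁))).exists
  -- Half of the slack `η` absorbs the shift by `A`, the other half the joint tail. The `+ 1` in the
  -- denominator covers `γ * K + C = 0`.
  obtain ⟨r, hr1, hr2⟩ : ∃ r, 1 < r ∧ (γ * K + C) * r ≤ γ * K + C + η / 2 := by
    have hs : 0 ≤ γ * K + C := add_nonneg (mul_nonneg hγ0 hK) hC
    refine ⟨1 + η / 2 / (γ * K + C + 1), by simp; positivity, ?_⟩
    rw [mul_add, mul_one, add_le_add_iff_left, mul_div_assoc', div_le_iff₀ (by linarith)]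
    nlinarith
  obtain ⟨x₀, hx₀⟩ := eventually_atTop.1 ((hG.eventually_tail_sub_le A hr1).and
    ((hG.eventually_jointTail_le A).and
      ((eventually_ge_atTop R).and (eventually_ge_atTop (A + A)))))
  refine ⟨x₀, fun n x hx => ?_⟩
  obtain ⟨h1, h2, h3, h4⟩ := hx₀ x hx
  have hH := hG.tail_pos x
  have hK'0 : 0 ≤ K' := by
    have := mul_nonneg hγ0 hK
    linarith
  cases n with
  | zero =>
    rw [h0 x h3]
    exact mul_nonneg hK'0 hH.le
  | succ n =>
    have a1 := prod_real_lt_add_le (x := x) hC hK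
      (fun t ht => hνC n t (hA2.trans ht)) (fun t ht => hθ n t (hA3.trans ht))
    have a2 := hνC n (x - A) (by linarith)
    have a3 := hθ n (x - A) (by linarith)
    have a5 : (ν n).real univ * (θ n).real (Ioi (x - A)) ≤ γ * (K * (r * tail G x)) :=
      mul_le_mul (hνγ n) (a3.trans (mul_le_mul_of_nonneg_left h1 hK)) measureReal_nonneg hγ0
    have a6 : (ν n).real (Ioi (x - A)) ≤ C * (r * tail G x) :=
      a2.trans (mul_le_mul_of_nonneg_left h1 hC)
    have a7 : C * K * jointTail G A x ≤ C * K * (3 * tail G A * tail G x) :=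
      mul_le_mul_of_nonneg_left h2 (mul_nonneg hC hK)
    have a8 : C * K * (3 * tail G A * tail G x) ≤ η / 2 * tail G x := by
      have := mul_le_mul_of_nonneg_right hA1.le hH.le
      linarith
    rw [probReal_univ (μ := θ n), mul_one] at a1
    have a9 : (θ (n + 1)).real (Ioi x) ≤ ((γ * K + C) * r + η / 2) * tail G x := by
      linarith [hrec n x h3]
    refine a9.trans (mul_le_mul_of_nonneg_right ?_ hH.le)
    linarith

/-- A defective renewal inequality with kernel of mass at most `γ < 1` and of tail at most `C` times
the tail of `G`: the solution has tail asymptotically at most `C / (1 - γ)` times the tail of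
`G`. -/
theorem IsSubexponential.eventually_tail_le_of_renewal (hG : IsSubexponential G)
    {θ ν : ℕ → Measure ℝ} [∀ n, IsProbabilityMeasure (θ n)] [∀ n, IsFiniteMeasure (ν n)]
    {γ C R : ℝ} (hγ : γ < 1) (hC : 0 ≤ C) (hνγ : ∀ n, (ν n).real univ ≤ γ)
    {t₀ : ℝ} (hνC : ∀ n, ∀ t ≥ t₀, (ν n).real (Ioi t) ≤ C * tail G t)
    (h0 : ∀ x ≥ R, (θ 0).real (Ioi x) = 0)
    (hrec : ∀ n, ∀ x ≥ R, (θ (n + 1)).real (Ioi x)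
      ≤ ((ν n).prod (θ n)).real {p | x < p.1 + p.2})
    {L : ℝ} (hL : C / (1 - γ) < L) :
    ∃ x₂, ∀ n, ∀ x ≥ x₂, (θ n).real (Ioi x) ≤ L * tail G x := by
  have hγ0 : 0 ≤ γ := measureReal_nonneg.trans (hνγ 0)
  -- If `K` is admissible, so is everything above `γ * K + C`. The infimum of admissible constants
  -- therefore lies below its own image under this contraction, hence below the fixed point `C / (1
  -- - γ)`.
  set S : Set ℝ := {K | 0 ≤ K ∧ ∃ x₁, ∀ n, ∀ x ≥ x₁, (θ n).real (Ioi x) ≤ K * tail G x}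
  have hne : S.Nonempty := hG.exists_tail_le_of_renewal hγ hC hνγ hνC h0 hrec
  have hbdd : BddBelow S := ⟨0, fun K hK => hK.1⟩
  have hinf : sInf S ≤ C / (1 - γ) := by
    rw [le_div_iff₀ (sub_pos.2 hγ)]
    have h1 : ∀ K ∈ S, sInf S ≤ γ * K + C := by
      intro K hK
      refine le_of_forall_pos_le_add fun η hη => csInf_le hbdd ⟨?_, ?_⟩
      · have := mul_nonneg hγ0 hK.1
        linarith
      · obtain ⟨hK0, x₁, hx₁⟩ := hK
        exact hG.eventually_tail_le_of_renewal_step hC hνγ hνC h0 hrec hK0 hx₁ (by linarith)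
    have h2 : sInf S ≤ γ * sInf S + C := by
      refine le_of_forall_pos_le_add fun η hη => ?_
      obtain ⟨K, hK, hKη⟩ := exists_lt_of_csInf_lt hne (lt_add_of_pos_right (sInf S) hη)
      have := h1 K hK
      nlinarith
    linarith
  obtain ⟨K, ⟨_, x₁, hx₁⟩, hKL⟩ := exists_lt_of_csInf_lt hne (hinf.trans_lt hL)
  exact ⟨x₁, fun n x hx => (hx₁ n x hx).trans
    (mul_le_mul_of_nonneg_right hKL.le (tail_nonneg G x))⟩

end Comparison

/-! ### Product laws on an event. -/

section Independence

/-- If `Z` is independent of the event `E` and the variable `Y` jointly, then on `E` the law of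
`(Y, Z)` is a product. -/
theorem measureReal_inter_lt_add {Ω : Type*} {m₁ m₂ mΩ : MeasurableSpace Ω}
    {P : Measure Ω} [IsProbabilityMeasure P] (hm₁ : m₁ ≤ mΩ) (hm₂ : m₂ ≤ mΩ) (h : Indep m₁ m₂ P)
    {E : Set Ω} (hE : MeasurableSet[m₁] E)
    {Y Z : Ω → ℝ} (hY : Measurable[m₁] Y) (hZ : Measurable[m₂] Z) (x : ℝ) :
    P.real (E ∩ {ω | x < Y ω + Z ω})
      = (((P.restrict E).map Y).prod (P.map Z)).real {p | x < p.1 + p.2} := by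
  have hY' : Measurable Y := hY.mono hm₁ le_rfl
  have hZ' : Measurable Z := hZ.mono hm₂ le_rfl
  have hprod : ((P.restrict E).map Y).prod (P.map Z)
      = (P.restrict E).map (fun ω => (Y ω, Z ω)) := by
    refine Measure.prod_eq fun s t hs ht => ?_
    rw [Measure.map_apply (hY'.prodMk hZ') (hs.prod ht), Measure.map_apply hY' hs,
      Measure.map_apply hZ' ht, Measure.restrict_apply ((hY'.prodMk hZ') (hs.prod ht)),
      Measure.restrict_apply (hY' hs)]
    have := (Indep_iff m₁ m₂ P).1 h (Y ⁻¹' s ∩ E) (Z ⁻¹' t) ((hY hs).inter hE) (hZ ht)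
    rw [← this]
    congr 1
    ext ω
    simp only [mem_inter_iff, mem_preimage, mem_prod]
    tauto
  rw [hprod, measureReal_def, measureReal_def,
    Measure.map_apply (hY'.prodMk hZ') (measurableSet_lt_add x),
    Measure.restrict_apply ((hY'.prodMk hZ') (measurableSet_lt_add x)), inter_comm]
  rfl

end Independence

/-! ### Riemann sums of tails and the integrated tail law. -/

section TailIntegral

theorem lintegral_Ioi_eq_add (p : ℝ → ℝ≥0∞) {y z : ℝ} (h : y ≤ z) :
    ∫⁻ u in Ioi y, p u = (∫⁻ u in Ioc y z, p u) + ∫⁻ u in Ioi z, p u := by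
  rw [← Ioc_union_Ioi_eq_Ioi h, lintegral_union measurableSet_Ioi (Ioc_disjoint_Ioi le_rfl)]

theorem sum_le_lintegral_Ioi {p : ℝ → ℝ≥0∞} (hp : Antitone p) {κ : ℝ} (hκ : 0 < κ) (y : ℝ)
    (N : ℕ) : ENNReal.ofReal κ * ∑ n ∈ Finset.range N, p (y + κ + κ * n)
      ≤ ∫⁻ u in Ioi y, p u := by
  -- Keeping the remaining integral on the left lets the induction peel off one cell at a time.
  have key : ENNReal.ofReal κ * ∑ n ∈ Finset.range N, p (y + κ + κ * n)
      + ∫⁻ u in Ioi (y + κ * N), p u ≤ ∫⁻ u in Ioi y, p u := by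
    induction N with
    | zero => simp
    | succ N ih =>
      refine le_trans ?_ ih
      rw [Finset.sum_range_succ, mul_add, add_assoc]
      gcongr
      rw [lintegral_Ioi_eq_add p (show y + κ * N ≤ y + κ * ((N + 1 : ℕ) : ℝ) by
        push_cast; nlinarith)]
      gcongr
      calc ENNReal.ofReal κ * p (y + κ + κ * N)
          = ∫⁻ _ in Ioc (y + κ * N) (y + κ * ((N + 1 : ℕ) : ℝ)), p (y + κ + κ * N) := by
            rw [setLIntegral_const, Real.volume_Ioc, mul_comm]
            congr 2
            push_cast
            ring
        _ ≤ _ := by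
            refine setLIntegral_mono' measurableSet_Ioc fun u hu => hp ?_
            have := hu.2
            push_cast at this
            linarith
  exact le_self_add.trans key

theorem lintegral_Ioi_le_sum_add {p : ℝ → ℝ≥0∞} (hp : Antitone p) {κ : ℝ} (hκ : 0 < κ) (y : ℝ)
    (N : ℕ) : ∫⁻ u in Ioi y, p u ≤ ENNReal.ofReal κ * ∑ n ∈ Finset.range N, p (y + κ * n)
      + ∫⁻ u in Ioi (y + κ * N), p u := by
  induction N with
  | zero => simp
  | succ N ih =>
    refine ih.trans ?_
    rw [Finset.sum_range_succ, mul_add, add_assoc]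
    gcongr
    rw [lintegral_Ioi_eq_add p (show y + κ * N ≤ y + κ * ((N + 1 : ℕ) : ℝ) by
      push_cast; nlinarith)]
    gcongr
    calc _ ≤ ∫⁻ _ in Ioc (y + κ * N) (y + κ * ((N + 1 : ℕ) : ℝ)), p (y + κ * N) :=
          setLIntegral_mono' measurableSet_Ioc fun u hu => hp hu.1.le
      _ = ENNReal.ofReal κ * p (y + κ * N) := by
          rw [setLIntegral_const, Real.volume_Ioc, mul_comm]
          congr 2
          push_cast
          ring

theorem antitone_measure_Ioi (μ : Measure ℝ) : Antitone fun u => μ (Ioi u) :=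
  fun _ _ h => measure_mono (Ioi_subset_Ioi h)

theorem tendsto_lintegral_Ioi_atTop {p : ℝ → ℝ≥0∞} {y : ℝ}
    (h : ∫⁻ u in Ioi y, p u ≠ ∞) :
    Tendsto (fun x => ∫⁻ u in Ioi x, p u) atTop (𝓝 0) := by
  have h1 := tendsto_measure_iInter_atTop (μ := volume.withDensity p) (s := fun x : ℝ => Ioi x)
    (fun x => measurableSet_Ioi.nullMeasurableSet) (fun _ _ h => Ioi_subset_Ioi h)
    ⟨y, by rwa [withDensity_apply _ measurableSet_Ioi]⟩
  have h0 : (⋂ x : ℝ, Ioi x) = ∅ := by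
    ext y
    simp only [mem_iInter, mem_Ioi, mem_empty_iff_false, iff_false, not_forall, not_lt]
    exact ⟨y, le_rfl⟩
  rw [h0, measure_empty] at h1
  exact h1.congr fun x => withDensity_apply _ measurableSet_Ioi

variable {F : Measure ℝ} [IsProbabilityMeasure F]

theorem integratedTail_nonneg (F : Measure ℝ) (x : ℝ) : 0 ≤ integratedTail F x :=
  ENNReal.toReal_nonneg

/-- The mass of `integratedTailLaw F` is `1 - l`, with `l` the limit of the integrated tail. Total
mass one forces `l = 0`, and so rules out a divergent integral. -/
theorem tendsto_integratedTail (hG : IsProbabilityMeasure (integratedTailLaw F)) :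
    Tendsto (integratedTail F) atTop (𝓝 0) := by
  obtain ⟨l, hl⟩ : ∃ l, Tendsto (integratedTail F) atTop (𝓝 l) :=
    ⟨_, tendsto_atTop_ciInf (integratedTail_antitone F)
      ⟨0, by rintro _ ⟨x, rfl⟩; exact integratedTail_nonneg F x⟩⟩
  have hl0 : 0 ≤ l := ge_of_tendsto' hl fun x => integratedTail_nonneg F x
  have htop : Tendsto (integratedTailCDF F) atTop (𝓝 (1 - l)) := by
    refine (hl.const_sub 1).congr' ?_
    filter_upwards [eventually_ge_atTop 0] with x hx
    exact (if_neg (not_lt.2 hx)).symm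
  have hbot : Tendsto (integratedTailCDF F) atBot (𝓝 0) := by
    refine tendsto_const_nhds.congr' ?_
    filter_upwards [eventually_lt_atBot 0] with x hx
    exact (if_pos hx).symm
  have h1 := (integratedTailCDF F).measure_univ hbot htop
  have h2 : (integratedTailCDF F).measure univ = 1 := hG.measure_univ
  rw [h2, sub_zero] at h1
  have h3 : (1 : ℝ) = 1 - l := by
    by_contra hne
    have : 1 - l < 1 := lt_of_le_of_ne (by linarith) (Ne.symm hne)
    have := (ENNReal.ofReal_lt_one).2 this
    exact this.ne h1.symm
  have : l = 0 := by linarith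
  rwa [this] at hl

theorem tail_integratedTailLaw (hG : IsProbabilityMeasure (integratedTailLaw F)) {x : ℝ}
    (hx : 0 ≤ x) : tail (integratedTailLaw F) x = integratedTail F x := by
  have htop : Tendsto (integratedTailCDF F) atTop (𝓝 1) := by
    have h := (tendsto_integratedTail hG).const_sub 1
    rw [sub_zero] at h
    refine h.congr' ?_
    filter_upwards [eventually_ge_atTop 0] with x hx
    exact (if_neg (not_lt.2 hx)).symm
  have h1 := (integratedTailCDF F).measure_Ioi htop x
  have h2 : (integratedTailCDF F) x = 1 - integratedTail F x := if_neg (not_lt.2 hx)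
  rw [h2, sub_sub_cancel] at h1
  rw [tail, measureReal_def, integratedTailLaw, h1,
    ENNReal.toReal_ofReal (integratedTail_nonneg F x)]

theorem eventually_lintegral_eq_tail (hG : IsProbabilityMeasure (integratedTailLaw F)) :
    ∀ᶠ x in atTop, ∫⁻ u in Ioi x, F (Ioi u)
      = ENNReal.ofReal (tail (integratedTailLaw F) x) := by
  filter_upwards [(tendsto_integratedTail hG).eventually (gt_mem_nhds one_pos),
    eventually_ge_atTop 0] with x hx hx0
  rw [tail_integratedTailLaw hG hx0]
  have hne : min 1 (∫⁻ u in Ioi x, F (Ioi u)) ≠ ∞ :=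
    ne_top_of_le_ne_top ENNReal.one_ne_top (min_le_left _ _)
  rw [integratedTail, ENNReal.ofReal_toReal hne]
  rcases le_total 1 (∫⁻ u in Ioi x, F (Ioi u)) with h | h
  · rw [integratedTail, min_eq_left h] at hx
    simp at hx
  · rw [min_eq_right h]

theorem eventually_lintegral_le_of_tail (hG : IsProbabilityMeasure (integratedTailLaw F))
    {μ : Measure ℝ} [IsFiniteMeasure μ] {D : ℝ} (hD : 0 ≤ D)
    (h : ∀ᶠ u in atTop, μ.real (Ioi u) ≤ D * tail F u) :
    ∀ᶠ x in atTop, ∫⁻ u in Ioi x, μ (Ioi u)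
      ≤ ENNReal.ofReal (D * tail (integratedTailLaw F) x) := by
  obtain ⟨x₀, hx₀⟩ := eventually_atTop.1 h
  filter_upwards [eventually_lintegral_eq_tail hG, eventually_ge_atTop x₀] with x hx hxx
  rw [ENNReal.ofReal_mul hD, ← hx, ← lintegral_const_mul' _ _ ENNReal.ofReal_ne_top]
  refine setLIntegral_mono' measurableSet_Ioi fun u hu => ?_
  rw [← ofReal_measureReal (μ := μ), ← ofReal_measureReal (μ := F), ← ENNReal.ofReal_mul hD]
  exact ENNReal.ofReal_le_ofReal (hx₀ u (hxx.trans (le_of_lt hu)))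

theorem eventually_le_lintegral_of_tail (hG : IsProbabilityMeasure (integratedTailLaw F))
    {μ : Measure ℝ} [IsFiniteMeasure μ] {D : ℝ} (hD : 0 ≤ D)
    (h : ∀ᶠ u in atTop, D * tail F u ≤ μ.real (Ioi u)) :
    ∀ᶠ x in atTop, ENNReal.ofReal (D * tail (integratedTailLaw F) x)
      ≤ ∫⁻ u in Ioi x, μ (Ioi u) := by
  obtain ⟨x₀, hx₀⟩ := eventually_atTop.1 h
  filter_upwards [eventually_lintegral_eq_tail hG, eventually_ge_atTop x₀] with x hx hxx
  rw [ENNReal.ofReal_mul hD, ← hx, ← lintegral_const_mul' _ _ ENNReal.ofReal_ne_top]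
  refine setLIntegral_mono' measurableSet_Ioi fun u hu => ?_
  rw [← ofReal_measureReal (μ := μ), ← ofReal_measureReal (μ := F), ← ENNReal.ofReal_mul hD]
  exact ENNReal.ofReal_le_ofReal (hx₀ u (hxx.trans (le_of_lt hu)))

end TailIntegral

/-! ### Partial sums, their maxima and almost sure boundedness. -/

section RandomWalk

/-- The partial sums of a sequence. -/
noncomputable def walk (s : ℕ → ℝ) (k : ℕ) : ℝ := ∑ i ∈ Finset.range k, s i

/-- The maximum of the first `n` partial sums of a sequence (and of the empty sum). -/
noncomputable def maxWalk (s : ℕ → ℝ) (n : ℕ) : ℝ := partialSups (walk s) n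

theorem walk_zero (s : ℕ → ℝ) : walk s 0 = 0 := Finset.sum_range_zero _

theorem walk_succ (s : ℕ → ℝ) (k : ℕ) : walk s (k + 1) = walk s k + s k :=
  Finset.sum_range_succ _ _

theorem walk_add (s : ℕ → ℝ) (k i : ℕ) :
    walk s (k + i) = walk s k + walk (fun j => s (k + j)) i := by
  simp only [walk, Finset.sum_range_add]

theorem walk_sub_const (s : ℕ → ℝ) (c : ℝ) (k : ℕ) :
    walk (fun i => s i - c) k = walk s k - c * k := by
  simp [walk, Finset.sum_sub_distrib, mul_comm]

theorem walk_le_maxWalk (s : ℕ → ℝ) {k n : ℕ} (h : k ≤ n) : walk s k ≤ maxWalk s n :=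
  le_partialSups_of_le _ h

theorem lt_maxWalk_iff {s : ℕ → ℝ} {n : ℕ} {x : ℝ} :
    x < maxWalk s n ↔ ∃ k ≤ n, x < walk s k := by
  rw [← not_iff_not]
  push Not
  exact partialSups_le_iff

theorem measurable_walk (k : ℕ) : Measurable fun s : ℕ → ℝ => walk s k :=
  Finset.measurable_sum _ fun i _ => measurable_pi_apply i

theorem measurable_maxWalk (n : ℕ) : Measurable fun s : ℕ → ℝ => maxWalk s n := by
  induction n with
  | zero =>
    simp only [maxWalk, partialSups_zero]
    exact measurable_walk 0
  | succ n ih =>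
    simp only [maxWalk, partialSups_add_one]
    exact ih.sup (measurable_walk (n + 1))

theorem bddAbove_range_of_tendsto_div {z : ℕ → ℝ} {δ : ℝ} (hδ : 0 < δ)
    (h : Tendsto (fun k : ℕ => z k / k) atTop (𝓝 (-δ))) : BddAbove (range z) := by
  refine Filter.IsBoundedUnder.bddAbove_range ⟨0, ?_⟩
  rw [eventually_map]
  filter_upwards [h.eventually (gt_mem_nhds (neg_lt_zero.2 hδ)), eventually_gt_atTop 0]
    with k hk hk0
  have : (0 : ℝ) < k := Nat.cast_pos.2 hk0
  by_contra hz
  exact absurd hk (not_lt.2 (div_nonneg (le_of_lt (not_le.1 hz)) this.le))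

variable {Ω : Type*} [MeasurableSpace Ω] {P : Measure Ω}

theorem measurableSet_exists_lt {Z : ℕ → Ω → ℝ} (hZ : ∀ k, Measurable (Z k)) (x : ℝ) :
    MeasurableSet {ω | ∃ k, x < Z k ω} := by
  have : {ω | ∃ k, x < Z k ω} = ⋃ k, {ω | x < Z k ω} := by ext; simp
  rw [this]
  exact MeasurableSet.iUnion fun k => measurableSet_lt measurable_const (hZ k)

theorem tendsto_measureReal_exists_lt [IsFiniteMeasure P] {Z : ℕ → Ω → ℝ}
    (hZ : ∀ k, Measurable (Z k)) (h : ∀ᵐ ω ∂P, BddAbove (range fun k => Z k ω)) :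
    Tendsto (fun R : ℝ => P.real {ω | ∃ k, R < Z k ω}) atTop (𝓝 0) := by
  have h1 := tendsto_measure_iInter_atTop (μ := P) (s := fun R : ℝ => {ω | ∃ k, R < Z k ω})
    (fun R => (measurableSet_exists_lt hZ R).nullMeasurableSet)
    (fun R R' hR ω hω => by
      obtain ⟨k, hk⟩ := hω
      exact ⟨k, lt_of_le_of_lt hR hk⟩) ⟨0, measure_ne_top _ _⟩
  have h0 : P (⋂ R : ℝ, {ω | ∃ k, R < Z k ω}) = 0 := by
    refine measure_mono_null (fun ω hω => ?_) (ae_iff.1 h)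
    simp only [mem_iInter, mem_ofPred_eq] at hω ⊢
    rintro ⟨R, hR⟩
    obtain ⟨k, hk⟩ := hω R
    exact absurd (hR ⟨k, rfl⟩) (not_le.2 hk)
  rw [h0] at h1
  exact (ENNReal.tendsto_toReal ENNReal.zero_ne_top).comp h1

/-! ### Independent identically distributed steps: shifts and independent blocks. -/

/-- A sequence of independent identically distributed real random variables. -/
structure IsIIDSeq (ξ : ℕ → Ω → ℝ) (P : Measure Ω) : Prop where
  measurable : ∀ n, Measurable (ξ n)
  indep : iIndepFun ξ P
  ident : ∀ n, IdentDistrib (ξ n) (ξ 0) P P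

variable {ξ : ℕ → Ω → ℝ}

theorem IsIIDSeq.shift (h : IsIIDSeq ξ P) (k : ℕ) : IsIIDSeq (fun n => ξ (k + n)) P where
  measurable _ := h.measurable _
  indep := h.indep.precomp (g := fun n => k + n) (add_right_injective k)
  ident _ := (h.ident _).trans (h.ident _).symm

/-- Both laws are infinite products of the same marginal. -/
theorem IsIIDSeq.map_shift [IsProbabilityMeasure P] (h : IsIIDSeq ξ P) (k : ℕ) :
    P.map (fun ω i => ξ (k + i) ω) = P.map (fun ω i => ξ i ω) := by
  rw [(iIndepFun_iff_map_fun_eq_infinitePi_map (h.shift k).measurable).1 (h.shift k).indep,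
    (iIndepFun_iff_map_fun_eq_infinitePi_map h.measurable).1 h.indep]
  congr 1
  ext1 i
  rw [(h.ident (k + i)).map_eq, (h.ident i).map_eq]

theorem IsIIDSeq.measurable_seq (h : IsIIDSeq ξ P) : Measurable fun ω i => ξ i ω :=
  measurable_pi_iff.2 h.measurable

theorem IsIIDSeq.map_maxWalk_shift [IsProbabilityMeasure P] (h : IsIIDSeq ξ P) (k n : ℕ) :
    P.map (fun ω => maxWalk (fun i => ξ (k + i) ω) n)
      = P.map (fun ω => maxWalk (fun i => ξ i ω) n) := by
  have h1 := congrArg (Measure.map fun s : ℕ → ℝ => maxWalk s n) (h.map_shift k)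
  rwa [Measure.map_map (measurable_maxWalk n) (h.shift k).measurable_seq,
    Measure.map_map (measurable_maxWalk n) h.measurable_seq] at h1

theorem IsIIDSeq.measurable_walk (h : IsIIDSeq ξ P) (k : ℕ) :
    Measurable fun ω => walk (fun i => ξ i ω) k :=
  (TandemTail.measurable_walk k).comp h.measurable_seq

theorem IsIIDSeq.measurable_maxWalk (h : IsIIDSeq ξ P) (n : ℕ) :
    Measurable fun ω => maxWalk (fun i => ξ i ω) n :=
  (TandemTail.measurable_maxWalk n).comp h.measurable_seq

theorem IsIIDSeq.tendsto_walk_div (h : IsIIDSeq ξ P) (hint : Integrable (ξ 0) P) :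
    ∀ᵐ ω ∂P, Tendsto (fun k : ℕ => walk (fun i => ξ i ω) k / k) atTop (𝓝 (∫ ω, ξ 0 ω ∂P)) :=
  strong_law_ae_real ξ hint (fun _ _ hij => h.indep.indepFun hij) h.ident

theorem IsIIDSeq.sub_const (h : IsIIDSeq ξ P) (c : ℝ) : IsIIDSeq (fun n ω => ξ n ω - c) P where
  measurable n := (h.measurable n).sub_const c
  indep := h.indep.comp (fun _ x => x - c) fun _ => measurable_id.sub_const c
  ident n := (h.ident n).comp (measurable_id.sub_const c)

theorem measurable_biSup_comap {Ω ι : Type*} {f : ι → Ω → ℝ} {S : Set ι} {i : ι} (hi : i ∈ S) :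
    Measurable[⨆ j ∈ S, MeasurableSpace.comap (f j) inferInstance] (f i) :=
  (comap_measurable (f i)).mono
    (le_biSup (fun j => MeasurableSpace.comap (f j) inferInstance) hi) le_rfl

theorem indep_biSup_comap {ι : Type*} {f : ι → Ω → ℝ} (hm : ∀ i, Measurable (f i))
    (h : iIndepFun f P) {S T : Set ι} (hST : Disjoint S T) :
    Indep (⨆ j ∈ S, MeasurableSpace.comap (f j) inferInstance)
      (⨆ j ∈ T, MeasurableSpace.comap (f j) inferInstance) P :=
  indep_iSup_of_disjoint (fun i => (hm i).comap_le) h hST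

theorem biSup_comap_le {ι : Type*} {f : ι → Ω → ℝ} (hm : ∀ i, Measurable (f i)) (S : Set ι) :
    (⨆ j ∈ S, MeasurableSpace.comap (f j) inferInstance) ≤ (inferInstance : MeasurableSpace Ω) :=
  iSup₂_le fun i _ => (hm i).comap_le

theorem measurable_walk_biSup_comap {Ω : Type*} {ξ : ℕ → Ω → ℝ} {k n : ℕ} (hk : k ≤ n) :
    Measurable[⨆ j ∈ Iio n, MeasurableSpace.comap (ξ j) inferInstance]
      (fun ω => walk (fun i => ξ i ω) k) :=
  Finset.measurable_sum _ fun _ hi =>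
    measurable_biSup_comap (lt_of_lt_of_le (Finset.mem_range.1 hi) hk)

theorem measurable_maxWalk_biSup_comap {Ω : Type*} {ξ : ℕ → Ω → ℝ} (k n : ℕ) :
    Measurable[⨆ j ∈ Ici k, MeasurableSpace.comap (ξ j) inferInstance]
      (fun ω => maxWalk (fun i => ξ (k + i) ω) n) := by
  have h : Measurable[⨆ j ∈ Ici k, MeasurableSpace.comap (ξ j) inferInstance]
      (fun ω i => ξ (k + i) ω) :=
    @measurable_pi_lambda _ _ _ (_) _ _
      fun i => measurable_biSup_comap (mem_Ici.2 (Nat.le_add_right k i))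
  exact (measurable_maxWalk n).comp h

/-! ### First crossing of a falling line. -/

/-- The walk crosses the line `R - κ k` for the first time at time `k`. -/
def crossing {Ω : Type*} (ξ : ℕ → Ω → ℝ) (R κ : ℝ) (k : ℕ) : Set Ω :=
  {ω | (∀ i < k, walk (fun i => ξ i ω) i ≤ R - κ * i) ∧ R - κ * k < walk (fun i => ξ i ω) k}

theorem measurableSet_crossing {Ω : Type*} {ξ : ℕ → Ω → ℝ} (R κ : ℝ) (k : ℕ) :
    MeasurableSet[⨆ j ∈ Iio k, MeasurableSpace.comap (ξ j) inferInstance]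
      (crossing ξ R κ k) := by
  have h1 : crossing ξ R κ k = (⋂ i, ⋂ _ : i < k, {ω | walk (fun i => ξ i ω) i ≤ R - κ * i})
      ∩ {ω | R - κ * k < walk (fun i => ξ i ω) k} := by
    ext ω
    simp [crossing]
  rw [h1]
  refine MeasurableSet.inter (MeasurableSet.iInter fun i => MeasurableSet.iInter fun hi => ?_) ?_
  · exact measurable_walk_biSup_comap hi.le measurableSet_Iic
  · exact measurable_walk_biSup_comap le_rfl measurableSet_Ioi

theorem disjoint_crossing {Ω : Type*} {ξ : ℕ → Ω → ℝ} (R κ : ℝ) {k l : ℕ} (hkl : k ≠ l) :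
    Disjoint (crossing ξ R κ k) (crossing ξ R κ l) := by
  rw [Set.disjoint_left]
  rintro ω ⟨h1, h2⟩ ⟨h3, h4⟩
  rcases lt_or_gt_of_ne hkl with h | h
  · exact absurd (h3 k h) (not_le.2 h2)
  · exact absurd (h1 l h) (not_le.2 h4)

/-- The law of the position of the walk at its first crossing of the line `R - κ k`, if the
crossing happens at a time `k ≤ n + 1`. -/
noncomputable def crossingLaw (P : Measure Ω) (ξ : ℕ → Ω → ℝ) (R κ : ℝ) (n : ℕ) : Measure ℝ :=
  ∑ k ∈ Finset.range (n + 1),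
    (P.restrict (crossing ξ R κ (k + 1))).map (fun ω => walk (fun i => ξ i ω) (k + 1))

instance [IsFiniteMeasure P] (R κ : ℝ) (n : ℕ) : IsFiniteMeasure (crossingLaw P ξ R κ n) := by
  unfold crossingLaw
  infer_instance

theorem crossingLaw_real_apply [IsFiniteMeasure P] (h : IsIIDSeq ξ P) (R κ : ℝ) (n : ℕ)
    {s : Set ℝ} (hs : MeasurableSet s) :
    (crossingLaw P ξ R κ n).real s = ∑ k ∈ Finset.range (n + 1),
      P.real (crossing ξ R κ (k + 1) ∩ {ω | walk (fun i => ξ i ω) (k + 1) ∈ s}) := by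
  rw [crossingLaw, measureReal_def, Measure.finsetSum_apply,
    ENNReal.toReal_sum fun _ _ => measure_ne_top _ _]
  refine Finset.sum_congr rfl fun k _ => ?_
  rw [Measure.map_apply (h.measurable_walk _) hs,
    Measure.restrict_apply (h.measurable_walk _ hs), inter_comm]
  rfl

/-- First crossings at different times are disjoint. When the drift is below `-κ`, the right side is
small for large `R`. -/
theorem crossingLaw_real_univ_le [IsFiniteMeasure P] (h : IsIIDSeq ξ P) (R κ : ℝ) (n : ℕ) :
    (crossingLaw P ξ R κ n).real univ
      ≤ P.real {ω | ∃ k : ℕ, R < walk (fun i => ξ i ω) k + κ * k} := by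
  rw [crossingLaw_real_apply h R κ n MeasurableSet.univ]
  simp only [mem_univ, ofPred_true, inter_univ]
  rw [← measureReal_biUnion_finset
    (fun k _ l _ hkl => disjoint_crossing R κ (fun hh => hkl (Nat.succ_injective hh)))
    (fun k _ => biSup_comap_le h.measurable _ _ (measurableSet_crossing R κ _))]
  refine measureReal_mono (iUnion₂_subset fun k _ ω hω => ⟨k + 1, ?_⟩)
  have := hω.2
  linarith

/-- Before a first crossing at time `k + 1` the walk is at most `R - κ * k`, so landing beyond `t`
takes a jump of more than `t - R + κ * k`. -/
theorem crossingLaw_real_Ioi_le [IsFiniteMeasure P] (h : IsIIDSeq ξ P) {R κ : ℝ} (n : ℕ) (t : ℝ) :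
    (crossingLaw P ξ R κ n).real (Ioi t)
      ≤ ∑ k ∈ Finset.range (n + 1), (P.map (ξ 0)).real (Ioi (t - R + κ * k)) := by
  rw [crossingLaw_real_apply h R κ n measurableSet_Ioi]
  refine Finset.sum_le_sum fun k _ => ?_
  rw [← (h.ident k).map_eq, measureReal_def (P.map (ξ k)),
    Measure.map_apply (h.measurable k) measurableSet_Ioi, ← measureReal_def]
  refine measureReal_mono fun ω hω => ?_
  have h1 := hω.1.1 k (Nat.lt_succ_self k)
  have h2 : t < walk (fun i => ξ i ω) (k + 1) := hω.2
  rw [walk_succ] at h2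
  simp only [mem_preimage, mem_Ioi]
  linarith

/-- The renewal inequality for the law of the maximum. -/
theorem maxWalk_renewal [IsProbabilityMeasure P] (h : IsIIDSeq ξ P) {R κ : ℝ} (hR : 0 ≤ R)
    (hκ : 0 ≤ κ) (n : ℕ) {x : ℝ} (hx : R ≤ x) :
    (P.map fun ω => maxWalk (fun i => ξ i ω) (n + 1)).real (Ioi x)
      ≤ ((crossingLaw P ξ R κ n).prod
          (P.map fun ω => maxWalk (fun i => ξ i ω) n)).real {p | x < p.1 + p.2} := by
  have hsum : ((crossingLaw P ξ R κ n).prod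
        (P.map fun ω => maxWalk (fun i => ξ i ω) n)).real {p | x < p.1 + p.2}
      = ∑ k ∈ Finset.range (n + 1), P.real (crossing ξ R κ (k + 1) ∩
          {ω | x < walk (fun i => ξ i ω) (k + 1) + maxWalk (fun i => ξ (k + 1 + i) ω) n}) := by
    have h1 : ∀ k, P.real (crossing ξ R κ (k + 1) ∩
          {ω | x < walk (fun i => ξ i ω) (k + 1) + maxWalk (fun i => ξ (k + 1 + i) ω) n})
        = (((P.restrict (crossing ξ R κ (k + 1))).map
            (fun ω => walk (fun i => ξ i ω) (k + 1))).prod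
          (P.map fun ω => maxWalk (fun i => ξ i ω) n)).real {p | x < p.1 + p.2} := by
      intro k
      rw [← h.map_maxWalk_shift (k + 1) n]
      exact measureReal_inter_lt_add (biSup_comap_le h.measurable _)
        (biSup_comap_le h.measurable _)
        (indep_biSup_comap h.measurable h.indep (Iio_disjoint_Ici le_rfl))
        (measurableSet_crossing R κ (k + 1)) (measurable_walk_biSup_comap le_rfl)
        (measurable_maxWalk_biSup_comap (k + 1) n) x
    simp only [h1, measureReal_def]
    rw [← ENNReal.toReal_sum fun _ _ => measure_ne_top _ _]
    congr 1
    simp only [Measure.prod_apply_symm (measurableSet_lt_add x), crossingLaw,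
      Measure.finsetSum_apply]
    rw [lintegral_finsetSum' _ fun k _ => ?_]
    exact (measurable_measure_prodMk_right (measurableSet_lt_add x)).aemeasurable
  rw [hsum, measureReal_def, Measure.map_apply (h.measurable_maxWalk _) measurableSet_Ioi,
    ← measureReal_def]
  refine (measureReal_mono (fun ω hω => ?_) (measure_ne_top _ _)).trans
    (measureReal_biUnion_finset_le _ _)
  obtain ⟨j, hj, hxj⟩ := lt_maxWalk_iff.1 (show x < maxWalk (fun i => ξ i ω) (n + 1) from hω)
  have hex : ∃ k : ℕ, R - κ * k < walk (fun i => ξ i ω) k :=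
    ⟨j, by have := mul_nonneg hκ (Nat.cast_nonneg (α := ℝ) j); linarith⟩
  classical
  have hle : Nat.find hex ≤ j := Nat.find_min' hex (by
    have := mul_nonneg hκ (Nat.cast_nonneg (α := ℝ) j); linarith)
  have hsp := Nat.find_spec hex
  have hmin : ∀ i < Nat.find hex, walk (fun i => ξ i ω) i ≤ R - κ * i :=
    fun i hi => not_lt.1 (Nat.find_min hex hi)
  -- Since `R ≥ 0`, the line is not crossed at time `0`; the remaining horizon is then at most `n`.
  obtain ⟨k, hk⟩ : ∃ k, Nat.find hex = k + 1 := by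
    refine Nat.exists_eq_succ_of_ne_zero fun h0 => ?_
    rw [h0, walk_zero] at hsp
    simp at hsp
    linarith
  rw [hk] at hle hsp hmin
  simp only [mem_iUnion, Finset.mem_range]
  refine ⟨k, by omega, ⟨hmin, hsp⟩, ?_⟩
  obtain ⟨i, rfl⟩ := Nat.exists_eq_add_of_le hle
  rw [walk_add] at hxj
  have := walk_le_maxWalk (fun j => ξ (k + 1 + j) ω) (show i ≤ n by omega)
  simp only [mem_ofPred_eq]
  linarith

theorem measureReal_iUnion_le_of_monotone [IsFiniteMeasure P] {s : ℕ → Set Ω} (hs : Monotone s)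
    {c : ℝ} (hc : ∀ n, P.real (s n) ≤ c) : P.real (⋃ n, s n) ≤ c :=
  le_of_tendsto' ((ENNReal.tendsto_toReal (measure_ne_top _ _)).comp
    (tendsto_measure_iUnion_atTop hs)) hc

theorem measureReal_exists_lt_walk_le [IsFiniteMeasure P] (h : IsIIDSeq ξ P) {x c : ℝ}
    (hc : ∀ n, (P.map fun ω => maxWalk (fun i => ξ i ω) n).real (Ioi x) ≤ c) :
    P.real {ω | ∃ k, x < walk (fun i => ξ i ω) k} ≤ c := by
  have h1 : {ω | ∃ k, x < walk (fun i => ξ i ω) k}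
      = ⋃ n, {ω | x < maxWalk (fun i => ξ i ω) n} := by
    ext ω
    simp only [mem_ofPred_eq, mem_iUnion, lt_maxWalk_iff]
    exact ⟨fun ⟨k, hk⟩ => ⟨k, k, le_rfl, hk⟩, fun ⟨_, k, _, hk⟩ => ⟨k, hk⟩⟩
  rw [h1]
  refine measureReal_iUnion_le_of_monotone (fun n m hnm ω hω => ?_) fun n => ?_
  · exact lt_of_lt_of_le (show x < maxWalk (fun i => ξ i ω) n from hω)
      ((partialSups _).monotone hnm)
  · have := hc n
    rwa [measureReal_def, Measure.map_apply (h.measurable_maxWalk _) measurableSet_Ioi,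
      ← measureReal_def] at this

/-! ### Two-sided bounds for the maximum of a random walk with negative drift. -/

/-- The tail of the maximum of a random walk with negative drift: upper bound, for all finite
horizons. -/
theorem IsSubexponential.maxWalk_tail_le [IsProbabilityMeasure P] {G : Measure ℝ}
    (hG : IsSubexponential G) (h : IsIIDSeq ξ P) (hint : Integrable (ξ 0) P) {δ : ℝ} (hδ : 0 < δ)
    (hmean : ∫ ω, ξ 0 ω ∂P = -δ) {d : ℝ} (hd : 0 ≤ d)
    (htail : ∀ D > d, ∀ᶠ x in atTop, ∫⁻ u in Ioi x, (P.map (ξ 0)) (Ioi u)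
      ≤ ENNReal.ofReal (D * tail G x))
    {L : ℝ} (hL : d / δ < L) :
    ∃ x₀, ∀ n, ∀ x ≥ x₀, (P.map fun ω => maxWalk (fun i => ξ i ω) n).real (Ioi x)
      ≤ L * tail G x := by
  have := hG.isProbabilityMeasure
  have hL0 : 0 < L := (div_nonneg hd hδ.le).trans_lt hL
  -- Here `κ` is the slope of the crossed line, `D` replaces `d`, and `C` and `γ` bound the tail and
  -- the mass of the kernel. They are chosen with `D / κ < C` and `C / (1 - γ) < L`.
  have hdL : d / L < δ := by
    rw [div_lt_iff₀ hL0]; rw [div_lt_iff₀ hδ] at hL; linarith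
  obtain ⟨κ, hκ1, hκ2⟩ := exists_between hdL
  have hκ0 : 0 < κ := (div_nonneg hd hL0.le).trans_lt hκ1
  have hd' : d < κ * L := (div_lt_iff₀ hL0).1 hκ1
  obtain ⟨D, hD1, hD2⟩ := exists_between hd'
  have hD0 : 0 < D := hd.trans_lt hD1
  have hDL : D / κ < L := by rw [div_lt_iff₀ hκ0]; linarith
  obtain ⟨C, hC1, hC2⟩ := exists_between hDL
  have hC0 : 0 < C := (by positivity : 0 < D / κ).trans hC1
  have hγ : 0 < 1 - C / L := by
    rw [sub_pos, div_lt_one hL0]; exact hC2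
  obtain ⟨γ, hγ1, hγ2⟩ := exists_between hγ
  have hγlt : γ < 1 := hγ2.trans_le (by have : 0 ≤ C / L := by positivity
                                        linarith)
  have hCγ : C / (1 - γ) < L := by
    rw [div_lt_iff₀ (by linarith)]
    have := (div_lt_iff₀ hL0).1 (show C / L < 1 - γ by linarith)
    linarith
  have hbdd : ∀ᵐ ω ∂P, BddAbove (range fun k : ℕ => walk (fun i => ξ i ω) k + κ * k) := by
    filter_upwards [h.tendsto_walk_div hint] with ω hω
    refine bddAbove_range_of_tendsto_div (δ := δ - κ) (by linarith) ?_
    rw [hmean] at hω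
    have h1 := hω.add_const κ
    rw [show -δ + κ = -(δ - κ) by ring] at h1
    refine h1.congr' ?_
    filter_upwards [eventually_gt_atTop 0] with k hk
    have : (k : ℝ) ≠ 0 := Nat.cast_ne_zero.2 hk.ne'
    field_simp
  have hlim := tendsto_measureReal_exists_lt (P := P)
    (fun k => (h.measurable_walk k).add_const (κ * k)) hbdd
  obtain ⟨R, hR1, hR2⟩ := ((hlim.eventually (gt_mem_nhds hγ1)).and (eventually_ge_atTop 0)).exists
  have hr : 1 < C / (D / κ) := by rwa [one_lt_div (by positivity)]
  -- The shift is `R + κ` because the Riemann sum starts one cell to the right of the integral.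
  obtain ⟨t₀, ht₀⟩ := eventually_atTop.1 ((hG.eventually_tail_sub_le (R + κ) hr).and
    ((tendsto_atTop_add_const_right atTop (-(R + κ)) tendsto_id).eventually (htail D hD1)))
  have hprob : ∀ n, IsProbabilityMeasure (P.map fun ω => maxWalk (fun i => ξ i ω) n) :=
    fun n => Measure.isProbabilityMeasure_map (h.measurable_maxWalk n).aemeasurable
  refine hG.eventually_tail_le_of_renewal
    (θ := fun n => P.map fun ω => maxWalk (fun i => ξ i ω) n)
    (ν := fun n => crossingLaw P ξ R κ n) (R := R) (t₀ := t₀) hγlt hC0.le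
    (fun n => (crossingLaw_real_univ_le h R κ n).trans hR1.le) ?_ ?_
    (fun n x hx => maxWalk_renewal h hR2 hκ0.le n hx) hCγ
  · intro n t ht
    obtain ⟨h1, h2⟩ := ht₀ t ht
    refine (crossingLaw_real_Ioi_le h n t).trans ?_
    have h3 := (sum_le_lintegral_Ioi (antitone_measure_Ioi (P.map (ξ 0))) hκ0
      (t - (R + κ)) (n + 1)).trans h2
    have h4 := ENNReal.toReal_mono ENNReal.ofReal_ne_top h3
    rw [ENNReal.toReal_mul, ENNReal.toReal_ofReal hκ0.le,
      ENNReal.toReal_sum fun _ _ => measure_ne_top _ _,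
      ENNReal.toReal_ofReal (mul_nonneg hD0.le (tail_nonneg _ _))] at h4
    have h5 : ∀ k : ℕ, t - (R + κ) + κ + κ * (k : ℝ) = t - R + κ * k := fun k => by ring
    simp only [h5, id, ← sub_eq_add_neg] at h4
    have h6 : D * tail G (t - (R + κ)) ≤ κ * (C * tail G t) := by
      calc D * tail G (t - (R + κ)) ≤ D * (C / (D / κ) * tail G t) :=
            mul_le_mul_of_nonneg_left h1 hD0.le
        _ = κ * (C * tail G t) := by field_simp
    exact le_of_mul_le_mul_left (h4.trans h6) hκ0
  · intro x hx
    have : (fun ω => maxWalk (fun i => ξ i ω) 0) = fun _ => 0 := by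
      ext ω
      simp [maxWalk, walk_zero]
    simp only [this, Measure.map_const, measure_univ, one_smul]
    rw [measureReal_def, Measure.dirac_apply' _ measurableSet_Ioi, indicator_of_notMem]
    · rfl
    · simp only [mem_Ioi, not_lt]; linarith

/-- The tail of the maximum of a random walk with negative drift: lower bound. -/
theorem IsSubexponential.eventually_le_walk_tail [IsProbabilityMeasure P] {G : Measure ℝ}
    (hG : IsSubexponential G) (h : IsIIDSeq ξ P) (hint : Integrable (ξ 0) P) {δ : ℝ} (hδ : 0 < δ)
    (hmean : ∫ ω, ξ 0 ω ∂P = -δ) {d : ℝ}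
    (hfin : ∃ y, ∫⁻ u in Ioi y, (P.map (ξ 0)) (Ioi u) ≠ ∞)
    (htail : ∀ D, 0 ≤ D → D < d → ∀ᶠ x in atTop, ENNReal.ofReal (D * tail G x)
      ≤ ∫⁻ u in Ioi x, (P.map (ξ 0)) (Ioi u))
    {L : ℝ} (hL : L < d / δ) :
    ∀ᶠ x in atTop, L * tail G x ≤ P.real {ω | ∃ k, x < walk (fun i => ξ i ω) k} := by
  have := hG.isProbabilityMeasure
  rcases lt_or_ge L 0 with hL0 | hL0
  · exact Eventually.of_forall fun x =>
      (mul_nonpos_of_nonpos_of_nonneg hL0.le (tail_nonneg G x)).trans measureReal_nonneg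
  have hLd : L * δ < d := (lt_div_iff₀ hδ).1 hL
  -- The increment over `δ` uses at most half of the gap `d - L * δ`; `L + 1` avoids division by
  -- zero.
  obtain ⟨κ, hκ1, hκ2⟩ : ∃ κ, δ < κ ∧ L * κ < d := by
    refine ⟨δ + (d - L * δ) / (2 * (L + 1)), ?_, ?_⟩
    · have : 0 < (d - L * δ) / (2 * (L + 1)) := div_pos (by linarith) (by linarith)
      linarith
    · have h1 : L * ((d - L * δ) / (2 * (L + 1))) ≤ (d - L * δ) / 2 := by
        rw [mul_div_assoc', div_le_div_iff₀ (by linarith) (by linarith)]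
        nlinarith
      linarith
  have hκ0 : 0 < κ := hδ.trans hκ1
  obtain ⟨D, hD1, hD2⟩ := exists_between hκ2
  have hD0 : 0 < D := (mul_nonneg hL0 hκ0.le).trans_lt hD1
  set q := L * κ / D with hq
  have hq0 : 0 ≤ q := by positivity
  have hq1 : q < 1 := (div_lt_one hD0).2 hD1
  -- By the inequality of means `r * r ≥ q`: one factor pays for the probability of `E n`, the other
  -- for the shift by `R`.
  set r := (1 + q) / 2 with hr
  have hr0 : 0 < r := by linarith
  have hr1 : r < 1 := by linarith
  have hrq : L * κ ≤ r * (D * r) := by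
    have h1 : q * D = L * κ := div_mul_cancel₀ _ hD0.ne'
    have h2 : q ≤ r * r := by rw [hr]; nlinarith [sq_nonneg (1 - q)]
    nlinarith
  have hη : 0 < (1 - r) / 2 := by linarith
  have hbdd1 : ∀ᵐ ω ∂P, BddAbove (range fun k : ℕ => walk (fun i => ξ i ω) k) := by
    filter_upwards [h.tendsto_walk_div hint] with ω hω
    rw [hmean] at hω
    exact bddAbove_range_of_tendsto_div hδ hω
  have hbdd2 : ∀ᵐ ω ∂P, BddAbove (range fun k : ℕ => -walk (fun i => ξ i ω) k - κ * k) := by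
    filter_upwards [h.tendsto_walk_div hint] with ω hω
    refine bddAbove_range_of_tendsto_div (δ := κ - δ) (by linarith) ?_
    rw [hmean] at hω
    have h1 := hω.neg.sub_const κ
    rw [show - -δ - κ = -(κ - δ) by ring] at h1
    refine h1.congr' ?_
    filter_upwards [eventually_gt_atTop 0] with k hk
    have : (k : ℝ) ≠ 0 := Nat.cast_ne_zero.2 hk.ne'
    field_simp
  have hm1 := fun k => h.measurable_walk k
  have hm2 : ∀ k : ℕ, Measurable fun ω => -walk (fun i => ξ i ω) k - κ * k :=
    fun k => (h.measurable_walk k).neg.sub_const (κ * k)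
  obtain ⟨R, hR⟩ := ((tendsto_measureReal_exists_lt (P := P) hm2 hbdd2).eventually
    (gt_mem_nhds hη)).exists
  filter_upwards [(tendsto_measureReal_exists_lt (P := P) hm1 hbdd1).eventually (gt_mem_nhds hη),
    hG.eventually_le_tail_sub (-R) hr1,
    (tendsto_atTop_add_const_right atTop R tendsto_id).eventually (htail D hD0.le hD2)]
    with x hx1 hx2 hx3
  simp only [id, sub_neg_eq_add] at hx2 hx3
  set m := P.real {ω | ∃ k, x < walk (fun i => ξ i ω) k} with hm
  -- On `E n` the walk has not exceeded `x` by time `n` and is at least `-R - κ * n`. The jump in `J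
  -- n`, independent of `E n`, then lifts it above `x` at time `n + 1`, so the events `E n ∩ J n`
  -- are disjoint.
  set E : ℕ → Set Ω := fun n => {ω | (∀ k ≤ n, walk (fun i => ξ i ω) k ≤ x)
    ∧ -R - κ * n ≤ walk (fun i => ξ i ω) n} with hE
  set J : ℕ → Set Ω := fun n => ξ n ⁻¹' Ioi (x + R + κ * n) with hJ
  have hEmeas : ∀ n, MeasurableSet[⨆ j ∈ Iio n, MeasurableSpace.comap (ξ j) inferInstance]
      (E n) := by
    intro n
    have h1 : E n = (⋂ k, ⋂ _ : k ≤ n, {ω | walk (fun i => ξ i ω) k ≤ x})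
        ∩ {ω | -R - κ * n ≤ walk (fun i => ξ i ω) n} := by
      ext ω
      simp [hE]
    rw [h1]
    refine MeasurableSet.inter (MeasurableSet.iInter fun i => MeasurableSet.iInter fun hi => ?_) ?_
    · exact measurable_walk_biSup_comap hi measurableSet_Iic
    · exact measurable_walk_biSup_comap le_rfl measurableSet_Ici
  have hEmeas' : ∀ n, MeasurableSet (E n) := fun n =>
    biSup_comap_le h.measurable _ _ (hEmeas n)
  have hEprob : ∀ n, r ≤ P.real (E n) := by
    intro n
    have h1 : (E n)ᶜ ⊆ {ω | ∃ k, x < walk (fun i => ξ i ω) k}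
        ∪ {ω | ∃ k : ℕ, R < -walk (fun i => ξ i ω) k - κ * k} := by
      intro ω hω
      by_contra hcon
      simp only [mem_union, mem_ofPred_eq, not_or, not_exists, not_lt] at hcon
      refine hω ⟨fun k _ => hcon.1 k, ?_⟩
      have := hcon.2 n
      linarith
    have h2 := (measureReal_mono (μ := P) h1).trans (measureReal_union_le _ _)
    rw [probReal_compl_eq_one_sub (hEmeas' n)] at h2
    linarith
  have hprod : ∀ n, P.real (E n ∩ J n)
      = P.real (E n) * (P.map (ξ 0)).real (Ioi (x + R + κ * n)) := by
    intro n
    have hI := indep_biSup_comap h.measurable h.indep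
      (Iio_disjoint_Ici (le_refl n))
    have h1 := (Indep_iff _ _ P).1 hI (E n) (J n) (hEmeas n)
      (measurable_biSup_comap (mem_Ici.2 le_rfl) measurableSet_Ioi)
    rw [measureReal_def, h1, ENNReal.toReal_mul, ← (h.ident n).map_eq,
      measureReal_def (P.map (ξ n)), Measure.map_apply (h.measurable n) measurableSet_Ioi]
    rfl
  have hexceed : ∀ n ω, ω ∈ E n ∩ J n → x < walk (fun i => ξ i ω) (n + 1) := by
    rintro n ω ⟨h1, h2⟩
    have h3 := h1.2
    have h4 : x + R + κ * n < ξ n ω := h2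
    rw [walk_succ]
    linarith
  have hdisj : ∀ n l, n ≠ l → Disjoint (E n ∩ J n) (E l ∩ J l) := by
    intro n l hnl
    rw [Set.disjoint_left]
    intro ω h1 h2
    rcases lt_or_gt_of_ne hnl with hlt | hlt
    · exact absurd (h2.1.1 (n + 1) hlt) (not_le.2 (hexceed n ω h1))
    · exact absurd (h1.1.1 (l + 1) hlt) (not_le.2 (hexceed l ω h2))
  have hsum : ∀ N, r * ∑ n ∈ Finset.range N, (P.map (ξ 0)).real (Ioi (x + R + κ * n)) ≤ m := by
    intro N
    calc r * ∑ n ∈ Finset.range N, (P.map (ξ 0)).real (Ioi (x + R + κ * n))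
        ≤ ∑ n ∈ Finset.range N, P.real (E n ∩ J n) := by
          rw [Finset.mul_sum]
          refine Finset.sum_le_sum fun n _ => ?_
          rw [hprod]
          exact mul_le_mul_of_nonneg_right (hEprob n) measureReal_nonneg
      _ = P.real (⋃ n ∈ Finset.range N, E n ∩ J n) :=
          (measureReal_biUnion_finset (fun n _ l _ hnl => hdisj n l hnl)
            (fun n _ => (hEmeas' n).inter (h.measurable n measurableSet_Ioi))).symm
      _ ≤ m := measureReal_mono (iUnion₂_subset fun n _ ω hω => ⟨n + 1, hexceed n ω hω⟩)
  obtain ⟨y, hy⟩ := hfin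
  -- The integral beyond the first `N` cells vanishes as `N → ∞` because some tail integral is
  -- finite.
  have hlim : Tendsto (fun N : ℕ => ENNReal.ofReal (κ * m / r)
      + ∫⁻ u in Ioi (x + R + κ * N), (P.map (ξ 0)) (Ioi u)) atTop
      (𝓝 (ENNReal.ofReal (κ * m / r) + 0)) := by
    refine tendsto_const_nhds.add ((tendsto_lintegral_Ioi_atTop hy).comp ?_)
    exact tendsto_atTop_add_const_left atTop (x + R)
      (tendsto_natCast_atTop_atTop.const_mul_atTop hκ0)
  have hfinal : ENNReal.ofReal (D * tail G (x + R)) ≤ ENNReal.ofReal (κ * m / r) + 0 := by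
    refine ge_of_tendsto' hlim fun N => hx3.trans ?_
    refine (lintegral_Ioi_le_sum_add (antitone_measure_Ioi (P.map (ξ 0))) hκ0 (x + R) N).trans ?_
    gcongr
    rw [← ENNReal.ofReal_toReal (ENNReal.sum_ne_top.2 fun _ _ => measure_ne_top _ _),
      ← ENNReal.ofReal_mul hκ0.le, ENNReal.toReal_sum fun _ _ => measure_ne_top _ _]
    refine ENNReal.ofReal_le_ofReal ?_
    rw [mul_div_assoc]
    refine mul_le_mul_of_nonneg_left ?_ hκ0.le
    rw [le_div_iff₀ hr0, mul_comm]
    exact hsum N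
  rw [add_zero, ENNReal.ofReal_le_ofReal_iff (by positivity), le_div_iff₀ hr0] at hfinal
  have h7 : L * κ * tail G x ≤ κ * m := by
    calc L * κ * tail G x ≤ r * (D * r) * tail G x :=
          mul_le_mul_of_nonneg_right hrq (tail_nonneg G x)
      _ = D * (r * tail G x) * r := by ring
      _ ≤ D * tail G (x + R) * r := by gcongr
      _ ≤ κ * m := hfinal
  nlinarith

end RandomWalk

/-! ### Waiting times and the output rate of the first queue. -/

section Queue

theorem lt_waiting_zero_iff {ξ : ℤ → ℝ} {x : ℝ} :
    (x : EReal) < waiting ξ 0 ↔ ∃ k, x < walk (fun i => ξ (-1 - i)) k := by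
  simp [waiting, lt_iSup_iff, walk]

theorem waiting_nonneg (ξ : ℤ → ℝ) (n : ℤ) : 0 ≤ waiting ξ n :=
  le_iSup_of_le 0 (by simp)

/-- The first `k` steps of the backward walk lead from customer `0` to customer `-k`; from there on
only its further increments count. -/
theorem waiting_neg_eq (ξ : ℤ → ℝ) (k : ℕ) :
    waiting ξ (-k) = ⨆ j : ℕ, ((walk (fun i => ξ (-1 - i)) (k + j)
      - walk (fun i => ξ (-1 - i)) k : ℝ) : EReal) := by
  refine iSup_congr fun j => ?_
  rw [walk_add, add_sub_cancel_left, walk]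
  congr 1
  refine Finset.sum_congr rfl fun i _ => ?_
  congr 1
  push_cast
  ring

/-- With negative drift the waiting times are finite and grow sublinearly backwards in time. -/
theorem exists_waiting_eq_coe {ξ : ℤ → ℝ} {δ : ℝ} (hδ : 0 < δ)
    (h : Tendsto (fun k : ℕ => walk (fun i => ξ (-1 - i)) k / k) atTop (𝓝 (-δ))) :
    ∃ w : ℕ → ℝ, (∀ k : ℕ, waiting ξ (-k) = (w k : EReal)) ∧
      Tendsto (fun k : ℕ => w k / k) atTop (𝓝 0) := by
  set z := walk (fun i => ξ (-1 - i)) with hz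
  obtain ⟨B, hB⟩ := bddAbove_range_of_tendsto_div hδ h
  have hle : ∀ (k : ℕ) (c : ℝ), (∀ j, z (k + j) - z k ≤ c) → waiting ξ (-k) ≤ (c : EReal) := by
    intro k c hc
    rw [waiting_neg_eq]
    exact iSup_le fun j => EReal.coe_le_coe_iff.2 (hc j)
  have hcoe : ∀ k : ℕ, waiting ξ (-k) = ((waiting ξ (-k)).toReal : EReal) := by
    intro k
    refine (EReal.coe_toReal (ne_of_lt ?_) (ne_of_gt ?_)).symm
    · exact (hle k (B - z k) fun j => sub_le_sub_right (hB ⟨k + j, rfl⟩) _).trans_lt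
        (EReal.coe_lt_top _)
    · exact EReal.bot_lt_zero.trans_le (waiting_nonneg ξ _)
  refine ⟨fun k => (waiting ξ (-k)).toReal, hcoe, tendsto_order.2 ⟨fun r hr => ?_, fun r hr => ?_⟩⟩
  · exact Eventually.of_forall fun k => hr.trans_le
      (div_nonneg (EReal.toReal_nonneg (waiting_nonneg ξ _)) (Nat.cast_nonneg k))
  -- For large `k` the walk is at least `-(δ + e) k` at time `k` and at most `-(δ - e) (k + j)` at
  -- time `k + j`; the increment is at most `2 e k`.
  · obtain ⟨e, he0, her, heδ⟩ : ∃ e, 0 < e ∧ 2 * e < r ∧ e < δ := by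
      refine ⟨min r δ / 3, by positivity, ?_, ?_⟩
      · have := min_le_left r δ
        linarith
      · have := min_le_right r δ
        linarith
    obtain ⟨K, hK⟩ := eventually_atTop.1 ((h.eventually (lt_mem_nhds
      (show -δ - e < -δ by linarith))).and (h.eventually (gt_mem_nhds
      (show -δ < -δ + e by linarith))))
    filter_upwards [eventually_ge_atTop K, eventually_gt_atTop 0] with k hkK hk0
    have hkpos : (0 : ℝ) < k := Nat.cast_pos.2 hk0
    have h1 : waiting ξ (-k) ≤ ((2 * e * k : ℝ) : EReal) := by
      refine hle k _ fun j => ?_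
      have hjpos : (0 : ℝ) < ((k + j : ℕ) : ℝ) := Nat.cast_pos.2 (by omega)
      have a1 := (lt_div_iff₀ hkpos).1 (hK k hkK).1
      have a2 := (div_lt_iff₀ hjpos).1 (hK (k + j) (by omega)).2
      push_cast at a2
      have a3 : 0 ≤ (δ - e) * (j : ℝ) := mul_nonneg (by linarith) (Nat.cast_nonneg j)
      nlinarith
    rw [hcoe k, EReal.coe_le_coe_iff] at h1
    rw [div_lt_iff₀ hkpos]
    nlinarith

/-- Idle time is nonnegative, so departures from the first queue are separated at least by its
service times. This is the only control on arrivals on the exceptional event in the upper bound. -/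
theorem le_interarrivalSecond (τ σ₁ : ℤ → ℝ) (n : ℤ) :
    σ₁ (n + 1) ≤ interarrivalSecond τ σ₁ n := by
  refine le_add_of_nonneg_left (EReal.toReal_nonneg ?_)
  rw [EReal.le_neg, neg_zero]
  exact min_le_left _ _

/-- By Lindley's recursion and `min + max = sum`, the idle time is `w' - (w + σ₁ n - τ n)`. In this
form sums telescope. -/
theorem interarrivalSecond_eq {τ σ₁ : ℤ → ℝ} {n : ℤ} {w w' : ℝ}
    (h : waitingFirst τ σ₁ n = w) (h' : waitingFirst τ σ₁ (n + 1) = w') :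
    interarrivalSecond τ σ₁ n = w' - w + τ n + (σ₁ (n + 1) - σ₁ n) := by
  have h1 : waitingFirst τ σ₁ (n + 1) = max 0 (waitingFirst τ σ₁ n + ((σ₁ n - τ n : ℝ) : EReal)) :=
    waiting_add_one _ _
  rw [h, h', ← EReal.coe_add, ← EReal.coe_zero, ← EReal.coe_strictMono.monotone.map_max,
    EReal.coe_eq_coe_iff] at h1
  rw [interarrivalSecond, h, ← EReal.coe_add, ← EReal.coe_zero, ← EReal.coe_strictMono.monotone.map_min,
    ← EReal.coe_neg, EReal.toReal_coe]
  have h2 := min_add_max 0 (w + (σ₁ n - τ n))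
  linarith

/-- The output of the first queue has the same rate as its input. -/
theorem tendsto_walk_interarrivalSecond {τ σ₁ : ℤ → ℝ} {a b : ℝ} (hab : b < a)
    (hτ : Tendsto (fun k : ℕ => walk (fun i => τ (-1 - i)) k / k) atTop (𝓝 a))
    (hσ : Tendsto (fun k : ℕ => walk (fun i => σ₁ (-1 - i)) k / k) atTop (𝓝 b))
    (hσ' : Tendsto (fun k : ℕ => walk (fun i => σ₁ (-i)) k / k) atTop (𝓝 b)) :
    Tendsto (fun k : ℕ => walk (fun i => interarrivalSecond τ σ₁ (-1 - i)) k / k) atTop (𝓝 a) := by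
  have hξ : Tendsto (fun k : ℕ => walk (fun i => (fun m => σ₁ m - τ m) (-1 - (i : ℤ))) k / k)
      atTop (𝓝 (-(a - b))) := by
    have := hσ.sub hτ
    rw [show b - a = -(a - b) by ring] at this
    refine this.congr fun k => ?_
    simp only [walk, Finset.sum_sub_distrib, sub_div]
  obtain ⟨w, hw, hwlim⟩ :=
    exists_waiting_eq_coe (ξ := fun m => σ₁ m - τ m) (sub_pos.2 hab) hξ
  have hwalk : ∀ k : ℕ, walk (fun i => interarrivalSecond τ σ₁ (-1 - i)) k
      = w 0 - w k + walk (fun i => τ (-1 - i)) k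
        + (walk (fun i => σ₁ (-i)) k - walk (fun i => σ₁ (-1 - i)) k) := by
    intro k
    induction k with
    | zero => simp [walk_zero]
    | succ k ih =>
      have e1 : waitingFirst τ σ₁ (-1 - k) = w (k + 1) := by
        rw [← hw (k + 1), waitingFirst]
        congr 1
        push_cast
        ring
      have e2 : waitingFirst τ σ₁ (-1 - k + 1) = w k := by
        rw [← hw k, waitingFirst]
        congr 1
        ring
      rw [walk_succ, ih, interarrivalSecond_eq e1 e2, walk_succ, walk_succ, walk_succ,
        show (-1 - (k : ℤ) + 1) = -k by ring]
      ring
  have hw0 : Tendsto (fun k : ℕ => w 0 / (k : ℝ)) atTop (𝓝 0) :=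
    tendsto_const_div_atTop_nhds_zero_nat _
  have hall := ((hw0.sub hwlim).add hτ).add (hσ'.sub hσ)
  rw [sub_self, zero_add, sub_self, add_zero] at hall
  refine hall.congr fun k => ?_
  rw [hwalk]
  ring

theorem measurable_interarrivalSecond {Ω : Type*} {m : MeasurableSpace Ω} {τ σ₁ : ℤ → Ω → ℝ}
    (hτ : ∀ n, Measurable (τ n)) (hσ : ∀ n, Measurable (σ₁ n)) (n : ℤ) :
    Measurable fun ω => interarrivalSecond (fun n => τ n ω) (fun n => σ₁ n ω) n := by
  unfold interarrivalSecond waitingFirst waiting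
  refine Measurable.add ?_ (hσ _)
  refine measurable_ereal_toReal.comp (Measurable.neg (measurable_const.min (Measurable.add ?_ ?_)))
  · exact Measurable.iSup fun k => measurable_coe_real_ereal.comp
      (Finset.measurable_sum _ fun i _ => (hσ _).sub (hτ _))
  · exact measurable_coe_real_ereal.comp ((hσ _).sub (hτ _))

end Queue

/-! ### Replacing an independent arrival stream by a line. -/

section IndependentArrivals

theorem lintegral_Ioi_map_sub_const {Ω : Type*} [MeasurableSpace Ω] {P : Measure Ω} {f : Ω → ℝ}
    (hf : Measurable f) (c x : ℝ) :
    ∫⁻ u in Ioi x, (P.map fun ω => f ω - c) (Ioi u) = ∫⁻ u in Ioi (x + c), (P.map f) (Ioi u) := by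
  have h1 : ∀ u, (P.map fun ω => f ω - c) (Ioi u) = (P.map f) (Ioi (u + c)) := by
    intro u
    rw [Measure.map_apply (hf.sub_const c) measurableSet_Ioi,
      Measure.map_apply hf measurableSet_Ioi]
    congr 1
    ext ω
    simp [lt_sub_iff_add_lt]
  simp only [h1]
  have h2 := (measurePreserving_add_right volume c).setLIntegral_comp_preimage
    (measurableSet_Ioi (a := x + c)) (antitone_measure_Ioi (P.map f)).measurable
  rw [← h2]
  congr 2
  ext u
  simp

variable {Ω : Type*} {m₁ m₂ mΩ : MeasurableSpace Ω} {P : Measure Ω} [IsProbabilityMeasure P]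
  {G : Measure ℝ} {s : ℕ → Ω → ℝ} {b d : ℝ}

theorem IsSubexponential.maxWalk_sub_const_tail_le (hG : IsSubexponential G) (hs : IsIIDSeq s P)
    (hint : Integrable (s 0) P) (hmean : ∫ ω, s 0 ω ∂P = b) (hd : 0 ≤ d)
    (hup : ∀ D > d, ∀ᶠ x in atTop, ∫⁻ u in Ioi x, (P.map (s 0)) (Ioi u)
      ≤ ENNReal.ofReal (D * tail G x))
    {c L : ℝ} (hc : b < c) (hL : d / (c - b) < L) :
    ∃ x₀, ∀ n, ∀ x ≥ x₀, (P.map fun ω => maxWalk (fun i => s i ω - c) n).real (Ioi x)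
      ≤ L * tail G x := by
  refine hG.maxWalk_tail_le (hs.sub_const c) (hint.sub (integrable_const c)) (sub_pos.2 hc) ?_ hd
    ?_ hL
  · rw [integral_sub hint (integrable_const c), hmean]
    simp
  · intro D hD
    obtain ⟨D', hD1, hD2⟩ := exists_between hD
    have hD'0 : 0 < D' := hd.trans_lt hD1
    filter_upwards [(tendsto_atTop_add_const_right atTop c tendsto_id).eventually (hup D' hD1),
      hG.eventually_tail_sub_le (-c) (show 1 < D / D' by rwa [one_lt_div hD'0])] with x h1 h2
    rw [lintegral_Ioi_map_sub_const (hs.measurable 0)]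
    refine h1.trans (ENNReal.ofReal_le_ofReal ?_)
    rw [sub_neg_eq_add] at h2
    calc D' * tail G (x + c) ≤ D' * (D / D' * tail G x) := by gcongr
      _ = D * tail G x := by field_simp

theorem IsSubexponential.eventually_le_walk_sub_const_tail (hG : IsSubexponential G)
    (hs : IsIIDSeq s P) (hint : Integrable (s 0) P) (hmean : ∫ ω, s 0 ω ∂P = b)
    (hup : ∀ D > d, ∀ᶠ x in atTop, ∫⁻ u in Ioi x, (P.map (s 0)) (Ioi u)
      ≤ ENNReal.ofReal (D * tail G x))
    (hlow : ∀ D, 0 ≤ D → D < d → ∀ᶠ x in atTop, ENNReal.ofReal (D * tail G x)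
      ≤ ∫⁻ u in Ioi x, (P.map (s 0)) (Ioi u))
    {c L : ℝ} (hc : b < c) (hL : L < d / (c - b)) :
    ∀ᶠ x in atTop, L * tail G x ≤ P.real {ω | ∃ k, x < walk (fun i => s i ω - c) k} := by
  refine hG.eventually_le_walk_tail (hs.sub_const c) (hint.sub (integrable_const c))
    (sub_pos.2 hc) ?_ ?_ ?_ hL
  · rw [integral_sub hint (integrable_const c), hmean]
    simp
  · obtain ⟨y, hy⟩ := (hup (d + 1) (by linarith)).exists
    refine ⟨y - c, ?_⟩
    rw [lintegral_Ioi_map_sub_const (hs.measurable 0), sub_add_cancel]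
    exact ne_top_of_le_ne_top ENNReal.ofReal_ne_top hy
  · intro D hD0 hD
    obtain ⟨D', hD1, hD2⟩ := exists_between hD
    have hD'0 : 0 < D' := hD0.trans_lt hD1
    filter_upwards [(tendsto_atTop_add_const_right atTop c tendsto_id).eventually
        (hlow D' hD'0.le hD2),
      hG.eventually_le_tail_sub (-c) (show D / D' < 1 by rwa [div_lt_one hD'0])] with x h1 h2
    rw [lintegral_Ioi_map_sub_const (hs.measurable 0)]
    refine le_trans (ENNReal.ofReal_le_ofReal ?_) h1
    rw [sub_neg_eq_add] at h2
    calc D * tail G x = D' * (D / D' * tail G x) := by field_simp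
      _ ≤ D' * tail G (x + c) := by gcongr

/-- For steps bounded from above the maximum of a random walk with negative drift has a tail
negligible with respect to that of any subexponential law. -/
theorem IsSubexponential.maxWalk_const_sub_tail_le (hG : IsSubexponential G) {r : ℕ → Ω → ℝ}
    (hr : IsIIDSeq r P) (hr0 : ∀ᵐ ω ∂P, 0 ≤ r 0 ω) (hint : Integrable (r 0) P)
    (hmean : ∫ ω, r 0 ω ∂P = b) {c C : ℝ} (hc : c < b) (hC : 0 < C) :
    ∃ x₀, ∀ n, ∀ x ≥ x₀, (P.map fun ω => maxWalk (fun i => c - r i ω) n).real (Ioi x)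
      ≤ C * tail G x := by
  have hiid : IsIIDSeq (fun n ω => c - r n ω) P :=
    { measurable := fun n => (hr.measurable n).const_sub c
      indep := hr.indep.comp (fun _ x => c - x) fun _ => measurable_id.const_sub c
      ident := fun n => (hr.ident n).comp (measurable_id.const_sub c) }
  refine hG.maxWalk_tail_le hiid ((integrable_const c).sub hint) (sub_pos.2 hc) ?_ le_rfl ?_
    (by simpa using hC)
  · rw [integral_sub (integrable_const c) hint, hmean]
    simp
  · intro D hD
    filter_upwards [eventually_ge_atTop c] with x hx
    -- The steps never exceed `c` almost surely, so the integrated tail vanishes beyond `c` and `d =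
    -- 0` applies.
    have : ∫⁻ u in Ioi x, (P.map fun ω => c - r 0 ω) (Ioi u) = ∫⁻ u in Ioi x, 0 := by
      refine setLIntegral_congr_fun measurableSet_Ioi fun u hu => ?_
      rw [Measure.map_apply (hiid.measurable 0) measurableSet_Ioi]
      refine measure_mono_null (fun ω hω => ?_) (ae_iff.1 hr0)
      simp only [mem_preimage, mem_Ioi] at hω hu
      simp only [mem_ofPred_eq, not_le]
      linarith
    rw [this]
    simp

/-- Subexponential services and an independent stream of arrivals with rate `1 / a`: lower bound. -/
theorem IsSubexponential.eventually_le_walk_sub_tail (hG : IsSubexponential G)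
    (hm₁ : m₁ ≤ mΩ) (hindep : Indep m₁ m₂ P)
    (hs : IsIIDSeq s P) (hsm : ∀ n, Measurable[m₂] (s n)) (hint : Integrable (s 0) P)
    (hmean : ∫ ω, s 0 ω ∂P = b)
    (hup : ∀ D > d, ∀ᶠ x in atTop, ∫⁻ u in Ioi x, (P.map (s 0)) (Ioi u)
      ≤ ENNReal.ofReal (D * tail G x))
    (hlow : ∀ D, 0 ≤ D → D < d → ∀ᶠ x in atTop, ENNReal.ofReal (D * tail G x)
      ≤ ∫⁻ u in Ioi x, (P.map (s 0)) (Ioi u))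
    {T : ℕ → Ω → ℝ} (hT : ∀ k, Measurable[m₁] (T k)) {a : ℝ} (hba : b < a)
    (hTlim : ∀ᵐ ω ∂P, Tendsto (fun k : ℕ => T k ω / k) atTop (𝓝 a))
    {L : ℝ} (hL : L < d / (a - b)) :
    ∀ᶠ x in atTop, L * tail G x ≤ P.real {ω | ∃ k, x < walk (fun i => s i ω) k - T k ω} := by
  have := hG.isProbabilityMeasure
  rcases lt_or_ge L 0 with hL0 | hL0
  · exact Eventually.of_forall fun x =>
      (mul_nonpos_of_nonpos_of_nonneg hL0.le (tail_nonneg G x)).trans measureReal_nonneg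
  have hab : 0 < a - b := sub_pos.2 hba
  obtain ⟨L₁, hL1, hL2⟩ := exists_between hL
  have hL10 : 0 < L₁ := hL0.trans_lt hL1
  have hac : a < b + d / L₁ := by
    rw [lt_div_iff₀ hab] at hL2
    have : a - b < d / L₁ := by rw [lt_div_iff₀ hL10]; linarith
    linarith
  -- The rate `c` lies above `a`, but so close that `d / (c - b)` still exceeds `L₁`.
  obtain ⟨c, hc1, hc2⟩ := exists_between hac
  have hbc : b < c := hba.trans hc1
  have hLc : L₁ < d / (c - b) := by
    have : c - b < d / L₁ := by linarith
    rw [lt_div_iff₀ hL10] at this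
    rw [lt_div_iff₀ (sub_pos.2 hbc)]
    linarith
  set q := L / L₁ with hq
  have hq0 : 0 ≤ q := by positivity
  have hq1 : q < 1 := (div_lt_one hL10).2 hL1
  set r := (1 + q) / 2 with hr
  have hr0 : 0 < r := by linarith
  have hr1 : r < 1 := by linarith
  have hrq : L ≤ r * (L₁ * r) := by
    have h1 : q * L₁ = L := div_mul_cancel₀ _ hL10.ne'
    have h2 : q ≤ r * r := by rw [hr]; nlinarith [sq_nonneg (1 - q)]
    nlinarith
  have hZ : ∀ k : ℕ, Measurable[m₁] fun ω => T k ω - c * k := fun k => (hT k).sub_const _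
  have hZlim : ∀ᵐ ω ∂P, BddAbove (range fun k : ℕ => T k ω - c * k) := by
    filter_upwards [hTlim] with ω hω
    refine bddAbove_range_of_tendsto_div (δ := c - a) (by linarith) ?_
    have h1 := hω.sub_const c
    rw [show a - c = -(c - a) by ring] at h1
    refine h1.congr' ?_
    filter_upwards [eventually_gt_atTop 0] with k hk
    have : (k : ℝ) ≠ 0 := Nat.cast_ne_zero.2 hk.ne'
    field_simp
  obtain ⟨R, hR⟩ := ((tendsto_measureReal_exists_lt (P := P)
    (fun k => (hZ k).mono hm₁ le_rfl) hZlim).eventually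
    (gt_mem_nhds (show 0 < 1 - r by linarith))).exists
  filter_upwards [hG.eventually_le_tail_sub (-R) hr1,
    (tendsto_atTop_add_const_right atTop R tendsto_id).eventually
      (hG.eventually_le_walk_sub_const_tail hs hint hmean hup hlow hbc hLc)] with x hx1 hx2
  simp only [id, sub_neg_eq_add] at hx1 hx2
  set B := {ω | ∃ k : ℕ, R < T k ω - c * k} with hB
  set E := {ω | ∃ k, x + R < walk (fun i => s i ω - c) k} with hE
  have hBm : MeasurableSet[m₁] B := @measurableSet_exists_lt Ω m₁ _ hZ R
  have hEm : MeasurableSet[m₂] E := @measurableSet_exists_lt Ω m₂ _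
    (fun k => Finset.measurable_sum _ fun i _ => (hsm i).sub_const c) (x + R)
  have hprod : P.real (Bᶜ ∩ E) = P.real Bᶜ * P.real E := by
    rw [measureReal_def, (Indep_iff _ _ P).1 hindep _ _ hBm.compl hEm, ENNReal.toReal_mul]
    rfl
  have hBr : r ≤ P.real Bᶜ := by
    rw [probReal_compl_eq_one_sub (hm₁ _ hBm)]
    linarith
  calc L * tail G x ≤ r * (L₁ * r) * tail G x :=
        mul_le_mul_of_nonneg_right hrq (tail_nonneg G x)
    _ = r * (L₁ * (r * tail G x)) := by ring
    _ ≤ r * (L₁ * tail G (x + R)) := by gcongr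
    _ ≤ P.real Bᶜ * P.real E :=
        mul_le_mul hBr hx2 (mul_nonneg hL10.le (tail_nonneg _ _)) measureReal_nonneg
    _ = P.real (Bᶜ ∩ E) := hprod.symm
    _ ≤ _ := by
        refine measureReal_mono ?_
        rintro ω ⟨h1, k, hk⟩
        refine ⟨k, ?_⟩
        have h2 : T k ω - c * k ≤ R := not_lt.1 fun h => h1 ⟨k, h⟩
        rw [walk_sub_const] at hk
        linarith

/-- Subexponential services and an independent stream of arrivals with rate `1 / a`, with
interarrival times at least equal to independent identically distributed variables with a mean
greater than that of the services: upper bound. -/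
theorem IsSubexponential.eventually_walk_sub_tail_le (hG : IsSubexponential G)
    (hm₁ : m₁ ≤ mΩ) (hm₂ : m₂ ≤ mΩ) (hindep : Indep m₁ m₂ P)
    (hs : IsIIDSeq s P) (hsm : ∀ n, Measurable[m₂] (s n)) (hint : Integrable (s 0) P)
    (hmean : ∫ ω, s 0 ω ∂P = b) (hd : 0 < d)
    (hup : ∀ D > d, ∀ᶠ x in atTop, ∫⁻ u in Ioi x, (P.map (s 0)) (Ioi u)
      ≤ ENNReal.ofReal (D * tail G x))
    {T : ℕ → Ω → ℝ} (hT : ∀ k, Measurable[m₁] (T k)) {a : ℝ} (hba : b < a)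
    (hTlim : ∀ᵐ ω ∂P, Tendsto (fun k : ℕ => T k ω / k) atTop (𝓝 a))
    {r : ℕ → Ω → ℝ} (hr : IsIIDSeq r P) (hrm : ∀ n, Measurable[m₁] (r n))
    (hr0 : ∀ᵐ ω ∂P, 0 ≤ r 0 ω) (hrint : Integrable (r 0) P) {b' : ℝ}
    (hrmean : ∫ ω, r 0 ω ∂P = b') (hbb : b < b')
    (hrT : ∀ k ω, walk (fun i => r i ω) k ≤ T k ω)
    {L : ℝ} (hL : d / (a - b) < L) :
    ∀ᶠ x in atTop, P.real {ω | ∃ k, x < walk (fun i => s i ω) k - T k ω} ≤ L * tail G x := by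
  have := hG.isProbabilityMeasure
  have hab : 0 < a - b := sub_pos.2 hba
  obtain ⟨L₁, hL1, hL2⟩ := exists_between hL
  obtain ⟨L₂, hL3, hL4⟩ := exists_between hL2
  have hL10 : 0 < L₁ := (by positivity : 0 < d / (a - b)).trans hL1
  have hca : b + d / L₁ < a := by
    rw [div_lt_iff₀ hab] at hL1
    have : d / L₁ < a - b := by rw [div_lt_iff₀ hL10]; linarith
    linarith
  obtain ⟨c, hc1, hc2⟩ := exists_between hca
  have hbc : b < c := by
    have : 0 < d / L₁ := by positivity
    linarith
  have hLc : d / (c - b) < L₁ := by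
    have : d / L₁ < c - b := by linarith
    rw [div_lt_iff₀ hL10] at this
    rw [div_lt_iff₀ (sub_pos.2 hbc)]
    linarith
  obtain ⟨c', hc'1, hc'2⟩ := exists_between hbb
  set K := d / (c' - b) + 1 with hK
  have hK0 : 0 < K := by
    have : 0 < d / (c' - b) := div_pos hd (sub_pos.2 hc'1)
    linarith
  -- The exceptional event will cost at most `η * (5 * K + 2)` times the tail, which `8 * (K + 1)`
  -- covers.
  set η := (L - L₂) / (8 * (K + 1)) with hη
  have hη0 : 0 < η := div_pos (by linarith) (by linarith)
  have hηL : η * (8 * (K + 1)) = L - L₂ := div_mul_cancel₀ _ (by positivity)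
  obtain ⟨x₁, hx₁⟩ := hG.maxWalk_sub_const_tail_le hs hint hmean hd.le hup hbc hLc
  obtain ⟨x₂, hx₂⟩ := hG.maxWalk_sub_const_tail_le hs hint hmean hd.le hup hc'1
    (show d / (c' - b) < K by linarith)
  obtain ⟨x₃, hx₃⟩ := hG.maxWalk_const_sub_tail_le hr hr0 hrint hrmean hc'2 hη0
  have hZ : ∀ k : ℕ, Measurable[m₁] fun ω => c * k - T k ω := fun k => (hT k).const_sub _
  have hZlim : ∀ᵐ ω ∂P, BddAbove (range fun k : ℕ => c * k - T k ω) := by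
    filter_upwards [hTlim] with ω hω
    refine bddAbove_range_of_tendsto_div (δ := a - c) (by linarith) ?_
    have h1 := hω.const_sub c
    rw [show c - a = -(a - c) by ring] at h1
    refine h1.congr' ?_
    filter_upwards [eventually_gt_atTop 0] with k hk
    have : (k : ℝ) ≠ 0 := Nat.cast_ne_zero.2 hk.ne'
    field_simp
  obtain ⟨R, hR⟩ := ((tendsto_measureReal_exists_lt (P := P)
    (fun k => (hZ k).mono hm₁ le_rfl) hZlim).eventually (gt_mem_nhds hη0)).exists
  set B := {ω | ∃ k : ℕ, R < c * k - T k ω} with hB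
  have hBm : MeasurableSet[m₁] B := @measurableSet_exists_lt Ω m₁ _ hZ R
  set A := max x₂ x₃ with hA
  have hA2 : x₂ ≤ A := le_max_left _ _
  have hA3 : x₃ ≤ A := le_max_right _ _
  have hM : ∀ n, Measurable[m₂] fun ω => maxWalk (fun i => s i ω - c') n := fun n =>
    (measurable_maxWalk n).comp (@measurable_pi_lambda _ _ _ m₂ _ _ fun i => (hsm i).sub_const c')
  have hN : ∀ n, Measurable[m₁] fun ω => maxWalk (fun i => c' - r i ω) n := fun n =>
    (measurable_maxWalk n).comp (@measurable_pi_lambda _ _ _ m₁ _ _ fun i => (hrm i).const_sub c')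
  filter_upwards [hG.eventually_tail_sub_le R (show 1 < L₂ / L₁ by rwa [one_lt_div hL10]),
    hG.eventually_tail_sub_le A one_lt_two, hG.eventually_jointTail_le A,
    eventually_ge_atTop (x₁ + R), eventually_ge_atTop (A + A)] with x h1 h2 h3 h4 h5
  have hH := hG.tail_pos x
  -- Off `B` the arrivals stay above the line `c * k - R`. On `B`, add and subtract `c' * k` and use
  -- that `T` dominates the walk of `r`.
  have hsub : {ω | ∃ k, x < walk (fun i => s i ω) k - T k ω}
      ⊆ {ω | ∃ k, x - R < walk (fun i => s i ω - c) k}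
        ∪ ⋃ n, (B ∩ {ω | x < maxWalk (fun i => c' - r i ω) n
          + maxWalk (fun i => s i ω - c') n}) := by
    rintro ω ⟨k, hk⟩
    by_cases hω : ω ∈ B
    · refine Or.inr (mem_iUnion.2 ⟨k, hω, ?_⟩)
      have e1 := walk_le_maxWalk (fun i => c' - r i ω) (le_refl k)
      have e2 := walk_le_maxWalk (fun i => s i ω - c') (le_refl k)
      have e3 : walk (fun i => c' - r i ω) k = c' * k - walk (fun i => r i ω) k := by
        simp [walk, Finset.sum_sub_distrib, mul_comm]
      rw [walk_sub_const] at e2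
      have e4 := hrT k ω
      simp only [mem_ofPred_eq]
      linarith
    · refine Or.inl ⟨k, ?_⟩
      have e1 : c * k - T k ω ≤ R := not_lt.1 fun h => hω ⟨k, h⟩
      rw [walk_sub_const]
      linarith
  have hfirst : P.real {ω | ∃ k, x - R < walk (fun i => s i ω - c) k} ≤ L₂ * tail G x := by
    refine (measureReal_exists_lt_walk_le (hs.sub_const c)
      (fun n => hx₁ n (x - R) (by linarith))).trans ?_
    calc L₁ * tail G (x - R) ≤ L₁ * (L₂ / L₁ * tail G x) := by gcongr
      _ = L₂ * tail G x := by field_simp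
  have hsecond : P.real (⋃ n, (B ∩ {ω | x < maxWalk (fun i => c' - r i ω) n
      + maxWalk (fun i => s i ω - c') n})) ≤ (L - L₂) * tail G x := by
    refine measureReal_iUnion_le_of_monotone ?_ fun n => ?_
    · rintro n n' hnn ω ⟨hω, hx⟩
      refine ⟨hω, lt_of_lt_of_le (show x < maxWalk (fun i => c' - r i ω) n
        + maxWalk (fun i => s i ω - c') n from hx) (add_le_add ?_ ?_)⟩
      · exact (partialSups _).monotone hnn
      · exact (partialSups _).monotone hnn
    · have hM' := (hM n).mono hm₂ le_rfl
      have hN' := (hN n).mono hm₁ le_rfl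
      have := Measure.isProbabilityMeasure_map (μ := P) hM'.aemeasurable
      -- Restriction to `B` only lowers the tail; what it gains is the total mass `η` in `hν1`.
      have hν : ∀ t ≥ A, ((P.restrict B).map fun ω => maxWalk (fun i => c' - r i ω) n).real (Ioi t)
          ≤ η * tail G t := by
        intro t ht
        refine le_trans (ENNReal.toReal_mono (measure_ne_top _ _)
          (Measure.map_mono Measure.restrict_le_self hN' (Ioi t))) (hx₃ n t (hA3.trans ht))
      have hν1 : ((P.restrict B).map fun ω => maxWalk (fun i => c' - r i ω) n).real univ ≤ η := by
        rw [measureReal_def, Measure.map_apply hN' MeasurableSet.univ, preimage_univ,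
          Measure.restrict_apply_univ, ← measureReal_def]
        exact hR.le
      rw [measureReal_inter_lt_add hm₁ hm₂ hindep hBm (hN n) (hM n) x]
      refine (prod_real_lt_add_le hη0.le hK0.le hν fun t ht => hx₂ n t (hA2.trans ht)).trans ?_
      rw [probReal_univ (μ := P.map fun ω => maxWalk (fun i => s i ω - c') n), mul_one]
      have f1 := mul_le_mul hν1 ((hx₂ n (x - A) (by linarith)).trans
        (mul_le_mul_of_nonneg_left h2 hK0.le)) measureReal_nonneg hη0.le
      have f2 := (hν (x - A) (by linarith)).trans (mul_le_mul_of_nonneg_left h2 hη0.le)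
      have f3 := mul_le_mul_of_nonneg_left h3 (mul_nonneg hη0.le hK0.le)
      have f4 : tail G A ≤ 1 := measureReal_le_one
      have f5 : η * K * (3 * tail G A * tail G x) ≤ η * K * (3 * 1 * tail G x) := by gcongr
      rw [← hηL]
      have f6 : 0 ≤ η * K * tail G x := by positivity
      have f7 : 0 ≤ η * tail G x := by positivity
      linarith
  refine (measureReal_mono hsub).trans ((measureReal_union_le _ _).trans ?_)
  linarith

end IndependentArrivals

end TandemTail

/-! ### Assembly for the tandem queue. -/

open TandemTail in
theorem theorem10 {Ω : Type*} [MeasurableSpace Ω] (P : Measure Ω) [IsProbabilityMeasure P]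
    (τ σ₁ σ₂ : ℤ → Ω → ℝ)
    -- interarrival times and service times are nonnegative random variables
    (hτ_meas : ∀ n, Measurable (τ n)) (hσ₁_meas : ∀ n, Measurable (σ₁ n))
    (hσ₂_meas : ∀ n, Measurable (σ₂ n))
    (hτ_nonneg : ∀ n, ∀ᵐ ω ∂P, 0 ≤ τ n ω) (hσ₁_nonneg : ∀ n, ∀ᵐ ω ∂P, 0 ≤ σ₁ n ω)
    (hσ₂_nonneg : ∀ n, ∀ᵐ ω ∂P, 0 ≤ σ₂ n ω)
    -- each of the three sequences is i.i.d., and they are mutually independent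
    (hindep : iIndepFun (fun i : ℤ ⊕ ℤ ⊕ ℤ => Sum.elim τ (Sum.elim σ₁ σ₂) i) P)
    (hτ_ident : ∀ n, IdentDistrib (τ n) (τ 0) P P)
    (hσ₁_ident : ∀ n, IdentDistrib (σ₁ n) (σ₁ 0) P P)
    (hσ₂_ident : ∀ n, IdentDistrib (σ₂ n) (σ₂ 0) P P)
    -- finite means `a > b₁ > b₂`
    (hτ_int : Integrable (τ 0) P) (hσ₁_int : Integrable (σ₁ 0) P)
    (hσ₂_int : Integrable (σ₂ 0) P)
    (a b₁ b₂ : ℝ) (ha : ∫ ω, τ 0 ω ∂P = a) (hb₁ : ∫ ω, σ₁ 0 ω ∂P = b₁)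
    (hb₂ : ∫ ω, σ₂ 0 ω ∂P = b₂) (hab : b₁ < a) (hbb : b₂ < b₁)
    -- the reference law on `[0, ∞)`, with subexponential integrated tail law
    (F : Measure ℝ) [IsProbabilityMeasure F] (hF_nonneg : F (Iio 0) = 0)
    (hFs : TandemTail.IsSubexponential (TandemTail.integratedTailLaw F))
    (d₂ : ℝ) (hd₂ : 0 < d₂)
    (hσ₂_tail : Tendsto (fun x => P.real {ω | x < σ₂ 0 ω} / TandemTail.tail F x) atTop (𝓝 d₂)) :
    Tendsto
      (fun x : ℝ =>
        P.real {ω | (x : EReal) <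
            TandemTail.waitingSecond (fun n => τ n ω) (fun n => σ₁ n ω) (fun n => σ₂ n ω) 0}
          / TandemTail.integratedTail F x)
      atTop (𝓝 (d₂ / (a - b₂))) := by
  have hGp := hFs.isProbabilityMeasure
  set f : ℤ ⊕ ℤ ⊕ ℤ → Ω → ℝ := fun i => Sum.elim τ (Sum.elim σ₁ σ₂) i with hf
  have hfm : ∀ i, Measurable (f i) := by
    rintro (n | n | n)
    exacts [hτ_meas n, hσ₁_meas n, hσ₂_meas n]
  have inj1 : Function.Injective fun i : ℕ => -1 - (i : ℤ) := fun i j h => by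
    have : -1 - (i : ℤ) = -1 - j := h
    omega
  -- Two backward numberings occur because the interarrival time with index `n` contains `σ₁ (n +
  -- 1)`: the index `-1 - i` becomes `-i`.
  have inj2 : Function.Injective fun i : ℕ => -(i : ℤ) := fun i j h => by
    have : -(i : ℤ) = -j := h
    omega
  have iid : ∀ {ρ : ℤ → Ω → ℝ} {g : ℕ → ℤ}, (∀ n, Measurable (ρ n)) → iIndepFun ρ P →
      (∀ n, IdentDistrib (ρ n) (ρ 0) P P) → Function.Injective g →
      IsIIDSeq (fun i : ℕ => ρ (g i)) P := fun h1 h2 h3 h4 =>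
    { measurable := fun _ => h1 _
      indep := h2.precomp h4
      ident := fun _ => (h3 _).trans (h3 _).symm }
  have indτ : iIndepFun τ P := hindep.precomp (g := Sum.inl) Sum.inl_injective
  have indσ₁ : iIndepFun σ₁ P := hindep.precomp (g := fun n => Sum.inr (Sum.inl n))
    (Sum.inr_injective.comp Sum.inl_injective)
  have indσ₂ : iIndepFun σ₂ P := hindep.precomp (g := fun n => Sum.inr (Sum.inr n))
    (Sum.inr_injective.comp Sum.inr_injective)
  have iidτ := iid hτ_meas indτ hτ_ident inj1
  have iidσ := iid hσ₁_meas indσ₁ hσ₁_ident inj1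
  have iidr := iid hσ₁_meas indσ₁ hσ₁_ident inj2
  have iids := iid hσ₂_meas indσ₂ hσ₂_ident inj1
  -- The second services generate one σ-algebra, everything that determines the arrivals at the
  -- second queue the other.
  set S : Set (ℤ ⊕ ℤ ⊕ ℤ) := range fun n => Sum.inr (Sum.inr n) with hS
  have hτm : ∀ n, Measurable[⨆ j ∈ Sᶜ, MeasurableSpace.comap (f j) inferInstance] (τ n) :=
    fun n => measurable_biSup_comap (f := f) (i := Sum.inl n) (by simp [hS])
  have hσm : ∀ n, Measurable[⨆ j ∈ Sᶜ, MeasurableSpace.comap (f j) inferInstance] (σ₁ n) :=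
    fun n => measurable_biSup_comap (f := f) (i := Sum.inr (Sum.inl n)) (by simp [hS])
  have hsm : ∀ n, Measurable[⨆ j ∈ S, MeasurableSpace.comap (f j) inferInstance] (σ₂ n) :=
    fun n => measurable_biSup_comap (f := f) (i := Sum.inr (Sum.inr n)) (by simp [hS])
  have hI := indep_biSup_comap hfm hindep (disjoint_compl_left (a := S))
  have hm₁ := biSup_comap_le hfm Sᶜ
  have hm₂ := biSup_comap_le hfm S
  have hTm : ∀ k, Measurable[⨆ j ∈ Sᶜ, MeasurableSpace.comap (f j) inferInstance] fun ω =>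
      walk (fun i => interarrivalSecond (fun n => τ n ω) (fun n => σ₁ n ω) (-1 - i)) k :=
    fun k => Finset.measurable_sum _ fun i _ => measurable_interarrivalSecond hτm hσm _
  have hTlim : ∀ᵐ ω ∂P, Tendsto (fun k : ℕ => walk (fun i =>
      interarrivalSecond (fun n => τ n ω) (fun n => σ₁ n ω) (-1 - i)) k / k) atTop (𝓝 a) := by
    have e1 := iidτ.tendsto_walk_div ((hτ_ident _).integrable_iff.2 hτ_int)
    have e2 := iidσ.tendsto_walk_div ((hσ₁_ident _).integrable_iff.2 hσ₁_int)
    have e3 := iidr.tendsto_walk_div ((hσ₁_ident _).integrable_iff.2 hσ₁_int)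
    rw [(hτ_ident _).integral_eq, ha] at e1
    rw [(hσ₁_ident _).integral_eq, hb₁] at e2
    rw [(hσ₁_ident _).integral_eq, hb₁] at e3
    filter_upwards [e1, e2, e3] with ω h1 h2 h3
    exact tendsto_walk_interarrivalSecond hab h1 h2 h3
  have hrT : ∀ k ω, walk (fun i => σ₁ (-i) ω) k ≤ walk (fun i =>
      interarrivalSecond (fun n => τ n ω) (fun n => σ₁ n ω) (-1 - i)) k := by
    intro k ω
    refine Finset.sum_le_sum fun i _ => ?_
    have := le_interarrivalSecond (fun n => τ n ω) (fun n => σ₁ n ω) (-1 - i)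
    rwa [show (-1 - (i : ℤ) + 1) = -i by ring] at this
  have hlaw : P.map (σ₂ (-1 - (0 : ℕ))) = P.map (σ₂ 0) := (hσ₂_ident _).map_eq
  have hreal : ∀ x, (P.map (σ₂ 0)).real (Ioi x) = P.real {ω | x < σ₂ 0 ω} := fun x => by
    rw [measureReal_def, Measure.map_apply (hσ₂_meas 0) measurableSet_Ioi]
    rfl
  have := Measure.isProbabilityMeasure_map (μ := P) (hσ₂_meas 0).aemeasurable
  -- Where the tail of `F` vanishes, the quotient is `0` by convention, which the positive limit
  -- `d₂` eventually excludes.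
  have hFpos : ∀ᶠ x in atTop, 0 < tail F x := by
    filter_upwards [hσ₂_tail.eventually (lt_mem_nhds hd₂)] with x hx
    refine lt_of_le_of_ne (tail_nonneg F x) fun h => ?_
    rw [← h, div_zero] at hx
    exact lt_irrefl _ hx
  have hup : ∀ D > d₂, ∀ᶠ x in atTop, ∫⁻ u in Ioi x, (P.map (σ₂ (-1 - (0 : ℕ)))) (Ioi u)
      ≤ ENNReal.ofReal (D * tail (integratedTailLaw F) x) := by
    intro D hD
    rw [hlaw]
    refine eventually_lintegral_le_of_tail hGp (hd₂.trans hD).le ?_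
    filter_upwards [hσ₂_tail.eventually (gt_mem_nhds hD), hFpos] with x hx hp
    rw [hreal]
    exact ((div_lt_iff₀ hp).1 hx).le
  have hlow : ∀ D, 0 ≤ D → D < d₂ → ∀ᶠ x in atTop,
      ENNReal.ofReal (D * tail (integratedTailLaw F) x)
        ≤ ∫⁻ u in Ioi x, (P.map (σ₂ (-1 - (0 : ℕ)))) (Ioi u) := by
    intro D hD0 hD
    rw [hlaw]
    refine eventually_le_lintegral_of_tail hGp hD0 ?_
    filter_upwards [hσ₂_tail.eventually (lt_mem_nhds hD), hFpos] with x hx hp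
    rw [hreal]
    exact ((lt_div_iff₀ hp).1 hx).le
  have hsint : Integrable (σ₂ (-1 - (0 : ℕ))) P := (hσ₂_ident _).integrable_iff.2 hσ₂_int
  have hsmean : ∫ ω, σ₂ (-1 - (0 : ℕ)) ω ∂P = b₂ := (hσ₂_ident _).integral_eq.trans hb₂
  have hrint : Integrable (σ₁ (-(0 : ℕ))) P := (hσ₁_ident _).integrable_iff.2 hσ₁_int
  have hrmean : ∫ ω, σ₁ (-(0 : ℕ)) ω ∂P = b₁ := (hσ₁_ident _).integral_eq.trans hb₁
  have hevent : ∀ x : ℝ, {ω | (x : EReal) <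
      waitingSecond (fun n => τ n ω) (fun n => σ₁ n ω) (fun n => σ₂ n ω) 0}
      = {ω | ∃ k, x < walk (fun i => σ₂ (-1 - i) ω) k - walk (fun i =>
          interarrivalSecond (fun n => τ n ω) (fun n => σ₁ n ω) (-1 - i)) k} := by
    intro x
    ext ω
    simp only [mem_ofPred_eq, waitingSecond, lt_waiting_zero_iff, walk, Finset.sum_sub_distrib]
  simp only [hevent]
  refine tendsto_order.2 ⟨fun l hl => ?_, fun l hl => ?_⟩
  · obtain ⟨l', hl1, hl2⟩ := exists_between hl
    filter_upwards [hFs.eventually_le_walk_sub_tail hm₁ hI iids (fun n => hsm _) hsint hsmean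
      hup hlow hTm (hbb.trans hab) hTlim hl2, eventually_ge_atTop 0] with x hx hx0
    rw [← tail_integratedTailLaw hGp hx0]
    exact hl1.trans_le ((le_div_iff₀ (hFs.tail_pos x)).2 hx)
  · obtain ⟨l', hl1, hl2⟩ := exists_between hl
    filter_upwards [hFs.eventually_walk_sub_tail_le hm₁ hm₂ hI iids (fun n => hsm _) hsint hsmean
      hd₂ hup hTm (hbb.trans hab) hTlim iidr (fun n => hσm _) (hσ₁_nonneg _) hrint hrmean hbb hrT
      hl1, eventually_ge_atTop 0] with x hx hx0
    rw [← tail_integratedTailLaw hGp hx0]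
    exact ((div_le_iff₀ (hFs.tail_pos x)).2 hx).trans_lt hl2
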